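/- Throughout, Lie groups are real, finite-dimensional and smooth. Let $G$ and $H$ be Lie groups with Lie algebras $\mathfrak g$ and $\mathfrak h$, let $\Phi: G\to\mathrm{Aut}(H)$ be a smooth action of $G$ on $H$ by Lie group automorphisms, and let $\mathcal B: H\to G$ be a relative Rota–Baxter operator, i.e. a smooth map with $$\mathcal B(h_1)\,\mathcal B(h_2)=\mathcal B\big(h_1\cdot\Phi(\mathcal B(h_1))h_2\big)\qquad\text{for all } h_1,h_2\in H.$$ *Group side.* The descendent Lie group $(H,\star)$ is the manifold $H$ with the product $h_1\star h_2=h_1\cdot\Phi(\mathcal B(h_1))h_2$ and the inverse $h^\dagger=\Phi(\mathcal B(h)^{-1})h^{-1}$. It acts linearly on $\mathfrak g$ by $\Theta(h)=(\Theta_h)_{*e}$, the tangent map at the identity of the diffeomorphism $\Theta_h:G\to G$, $\Theta_h(g)=\mathcal B(\Phi(g)h^\dagger)^{-1}\,g\,\mathcal B(h^\dagger)$. For $k\ge 1$ let $C^k(\mathcal B)$ be the space of smooth maps $F:H^{k-1}\to\mathfrak g$, with the group cochain differential $d^{\mathcal B}:C^k(\mathcal B)\to C^{k+1}(\mathcal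 B)$, $$d^{\mathcal B}F(h_1,\dots,h_k)=\Theta(h_1)F(h_2,\dots,h_k)+\sum_{i=1}^{k-1}(-1)^iF(h_1,\dots,h_i\star h_{i+1},\dots,h_k)+(-1)^kF(h_1,\dots,h_{k-1}),$$ and let $\mathcal H^k(\mathcal B)$ be the cohomology of this complex. *Lie algebra side.* Let $\phi:\mathfrak g\to\mathrm{Der}(\mathfrak h)$ be the differentiated action, i.e. the tangent map at $e$ of $g\mapsto\Phi(g)_{*e}$, and let $B=\mathrm{Diff}(\mathcal B)=\mathcal B_{*e}:\mathfrak h\to\mathfrak g$. The descendent Lie algebra is $\mathfrak h$ with the bracket $[u,v]_B=\phi(B(u))v-\phi(B(v))u+[u,v]_{\mathfrak h}$, and it acts on $\mathfrak g$ by $\theta(u)x=B(\phi(x)u)+[B(u),x]_{\mathfrak g}$. For $k\ge1$ let $C^k(\mathrm{Diff}(\mathcal B))=\mathrm{Hom}(\wedge^{k-1}\mathfrak h,\mathfrak g)$, with the Chevalley–Eilenberg differential $d_{CE}$ of $(\mathfrak h,[\cdot,\cdot]_B)$ with coefficients in $(\mathfrak g,\theta)$, $$d_{CE}f(u_1,\dots,u_k)=\sum_{i=1}^{k}(-1)^{i+1}\theta(u_i)f(u_1,\dots,\widehat{u_i},\dots,u_k)+\sum_{i<j}(-1)^{i+j}f([u_i,u_j]_B,u_1,\dots,\widehat{u_i},\dots,\widehat{u_j},\dots,u_k),$$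 and let $H^k(\mathrm{Diff}(\mathcal B))$ be the cohomology of this complex. *Theorem.* Let $\mathrm{Exp}:\mathfrak h\to H$ be the exponential map of $(H,\star)$. For $k\ge1$, $F\in C^k(\mathcal B)$ and $u_1,\dots,u_{k-1}\in\mathfrak h$, the formula $$\mathrm{VE}(F)(u_1,\dots,u_{k-1})=\sum_{s\in \mathrm{Sym}(k-1)}(-1)^{|s|}\frac{d}{dt_{1}}\cdots\frac{d}{dt_{k-1}}\bigg|_{t_1=\dots=t_{k-1}=0}F\big(\mathrm{Exp}(t_{1}u_{s(1)}),\dots,\mathrm{Exp}(t_{k-1}u_{s(k-1)})\big)$$ defines linear maps $\mathrm{VE}:C^k(\mathcal B)\to C^k(\mathrm{Diff}(\mathcal B))$, and these form a cochain map: $\mathrm{VE}\circ d^{\mathcal B}=d_{CE}\circ\mathrm{VE}$. Consequently $\mathrm{VE}$ induces homomorphisms $\mathrm{VE}_*:\mathcal H^k(\mathcal B)\to H^k(\mathrm{Diff}(\mathcal B))$, $[F]\mapsto[\mathrm{VE}(F)]$, for all $k\ge1$. -/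

import Mathlib

open scoped Manifold ContDiff

noncomputable section

namespace RotaBaxter

section LieGroups

variable {E : Type*} [NormedAddCommGroup E] [NormedSpace ℝ E]
  {L : Type*} [TopologicalSpace L] [ChartedSpace E L]
  {V : Type*} [NormedAddCommGroup V] [NormedSpace ℝ V]

instance lieGroup_minSmoothness [Group L] [LieGroup 𝓘(ℝ, E) ∞ L] :
    LieGroup 𝓘(ℝ, E) (minSmoothness ℝ 3) L :=
  LieGroup.of_le (n := ∞) (by simp only [minSmoothness_of_isRCLikeNormedField]; exact ENat.LEInfty.out)

theorem contMDiffAt_pi_iff {n : ℕ} {E' : Type*} [NormedAddCommGroup E'] [NormedSpace ℝ E']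
    {H' : Type*} [TopologicalSpace H'] {I : ModelWithCorners ℝ E' H'}
    {M : Type*} [TopologicalSpace M] [ChartedSpace H' M] {f : M → Fin n → L} {x : M} :
    ContMDiffAt I (ModelWithCorners.pi fun _ : Fin n => 𝓘(ℝ, E)) ∞ f x ↔
      ∀ i, ContMDiffAt I 𝓘(ℝ, E) ∞ (fun y => f y i) x := by
  have h : ∀ i, ContMDiffAt I 𝓘(ℝ, E) ∞ (fun y => f y i) x ↔ _ := fun i => contMDiffAt_iff_target
  rw [contMDiffAt_iff_target, continuousAt_pi, forall_congr' h, forall_and]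
  exact and_congr Iff.rfl contMDiffAt_pi_space

theorem contMDiff_pi_iff {n : ℕ} {E' : Type*} [NormedAddCommGroup E'] [NormedSpace ℝ E']
    {H' : Type*} [TopologicalSpace H'] {I : ModelWithCorners ℝ E' H'}
    {M : Type*} [TopologicalSpace M] [ChartedSpace H' M] {f : M → Fin n → L} :
    ContMDiff I (ModelWithCorners.pi fun _ : Fin n => 𝓘(ℝ, E)) ∞ f ↔
      ∀ i, ContMDiff I 𝓘(ℝ, E) ∞ (fun y => f y i) :=
  ⟨fun h i x => contMDiffAt_pi_iff.1 (h x) i, fun h x => contMDiffAt_pi_iff.2 fun i => h i x⟩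

theorem contMDiff_proj {n : ℕ} (i : Fin n) :
    ContMDiff (ModelWithCorners.pi fun _ : Fin n => 𝓘(ℝ, E)) 𝓘(ℝ, E) ∞
      (fun g : Fin n → L => g i) :=
  contMDiff_pi_iff.1 contMDiff_id i

variable [Group L] [LieGroup 𝓘(ℝ, E) ∞ L]

theorem exists_oneParameterCurve [FiniteDimensional ℝ E] [T2Space L]
    (u : GroupLieAlgebra 𝓘(ℝ, E) L) :
    ∃ γ : ℝ → L, γ 0 = 1 ∧ IsMIntegralCurve (I := 𝓘(ℝ, E)) γ (mulInvariantVectorField u) := by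
  have : CompleteSpace E := FiniteDimensional.complete ℝ E
  have hv : ContMDiff 𝓘(ℝ, E) 𝓘(ℝ, E).tangent 1
      (fun g : L => (⟨g, mulInvariantVectorField u g⟩ : TangentBundle 𝓘(ℝ, E) L)) :=
    (contMDiff_mulInvariantVectorField u).of_le (by
      simp only [minSmoothness_of_isRCLikeNormedField]; norm_num)
  obtain ⟨γ, h0, hγ⟩ := exists_isMIntegralCurveAt_of_contMDiffAt_boundaryless (t₀ := 0)
    (hv.contMDiffAt (x := (1 : L)))
  rw [isMIntegralCurveAt_iff'] at hγ
  obtain ⟨ε, hε, hγ⟩ := hγ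
  rw [Real.ball_eq_Ioo, zero_sub, zero_add] at hγ
  refine exists_isMIntegralCurve_of_isMIntegralCurveOn hv hε (fun g => ?_) 1
  refine ⟨fun t => g * γ t, by simp [h0], ?_⟩
  intro t ht
  have h1 : HasMFDerivAt 𝓘(ℝ, E) 𝓘(ℝ, E) (fun x : L => g * x) (γ t)
      (mfderiv 𝓘(ℝ, E) 𝓘(ℝ, E) (fun x : L => g * x) (γ t)) :=
    ((contMDiff_mul_left (I := 𝓘(ℝ, E)) (n := ∞) (a := g)).mdifferentiableAt
      (by simp)).hasMFDerivAt
  have h3 := mfderiv_comp_of_eq (I := 𝓘(ℝ, E)) (I' := 𝓘(ℝ, E)) (I'' := 𝓘(ℝ, E)) (x := (1 : L))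
    (y := γ t) (g := fun x : L => g * x) (f := fun x : L => γ t * x)
    ((contMDiff_mul_left (I := 𝓘(ℝ, E)) (n := ∞) (a := g)).mdifferentiableAt (by simp))
    ((contMDiff_mul_left (I := 𝓘(ℝ, E)) (n := ∞) (a := γ t)).mdifferentiableAt (by simp))
    (mul_one _)
  have h4 : (fun x : L => g * x) ∘ (fun x : L => γ t * x) = fun x => g * γ t * x := by
    ext x; simp [mul_assoc]
  rw [h4] at h3
  have h5 : mulInvariantVectorField (I := 𝓘(ℝ, E)) u (g * γ t) =
      mfderiv 𝓘(ℝ, E) 𝓘(ℝ, E) (fun x : L => g * x) (γ t) (mulInvariantVectorField u (γ t)) := by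
    have key : ∀ y : L, γ t * 1 = y → (mfderiv 𝓘(ℝ, E) 𝓘(ℝ, E) (fun x : L => g * γ t * x) 1 :
        E →L[ℝ] E) = (mfderiv 𝓘(ℝ, E) 𝓘(ℝ, E) (fun x : L => g * x) y : E →L[ℝ] E).comp
          (mfderiv 𝓘(ℝ, E) 𝓘(ℝ, E) (fun x : L => γ t * x) 1 : E →L[ℝ] E) := by
      rintro _ rfl
      exact h3
    exact congrArg (fun A : E →L[ℝ] E => A u) (key (γ t) (mul_one _))
  have h2 := h1.comp_hasMFDerivWithinAt t (hγ t ht)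
  have h8 : (mfderiv 𝓘(ℝ, E) 𝓘(ℝ, E) (fun x : L => g * x) (γ t)).comp
      (ContinuousLinearMap.smulRight (1 : ℝ →L[ℝ] ℝ) (mulInvariantVectorField u (γ t))) =
      ContinuousLinearMap.smulRight (1 : ℝ →L[ℝ] ℝ) (mulInvariantVectorField u (g * γ t)) := by
    rw [h5]
    apply ContinuousLinearMap.ext_ring
    simp
  exact (congrArg (fun A : ℝ →L[ℝ] E => HasMFDerivWithinAt 𝓘(ℝ, ℝ) 𝓘(ℝ, E)
    (fun t => g * γ t) (Set.Ioo (-ε) ε) t A) h8).mp h2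

/-- The exponential map `Exp`: the value at time `1` of the one-parameter curve through `1` with
initial velocity `u`, that is, of the integral curve of the left invariant field of `u`. -/
def lieExp [FiniteDimensional ℝ E] [T2Space L] (u : GroupLieAlgebra 𝓘(ℝ, E) L) : L :=
  Classical.choose (exists_oneParameterCurve u) 1

/-- The mixed derivative `d/dt₁ ⋯ d/dtₙ` at `t₁ = ⋯ = tₙ = 0`. -/
def mixedDeriv : (n : ℕ) → ((Fin n → ℝ) → V) → V
  | 0, g => g Fin.elim0
  | n + 1, g => deriv (fun t : ℝ => mixedDeriv n fun τ => g (Fin.cons t τ)) 0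

variable (E L V) in
/-- Smooth representations of the Lie group `L` on the vector space `V`. -/
structure SmoothRep where
  toHom : L →* (V →L[ℝ] V)
  smooth : ContMDiff 𝓘(ℝ, E) 𝓘(ℝ, V →L[ℝ] V) ∞ toHom

variable (E L V) in
/-- Smooth `n`-cochains: smooth maps `L × ⋯ × L → V` (`n` factors). -/
def SmoothCochain (n : ℕ) : Submodule ℝ ((Fin n → L) → V) where
  carrier := {F | ContMDiff (ModelWithCorners.pi fun _ : Fin n => 𝓘(ℝ, E)) 𝓘(ℝ, V) ∞ F}
  add_mem' hF hF' := ContMDiff.add hF hF'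
  zero_mem' := contMDiff_const
  smul_mem' c F hF := by
    have hF' : ContMDiff (ModelWithCorners.pi fun _ : Fin n => 𝓘(ℝ, E)) 𝓘(ℝ, V) ∞ F := hF
    exact (contDiff_const_smul (F := V) c).contMDiff.comp hF'

/-- The differential of the complex of smooth group cochains with coefficients in `ρ`. -/
def SmoothRep.d (ρ : SmoothRep E L V) (n : ℕ) :
    SmoothCochain E L V n →ₗ[ℝ] SmoothCochain E L V (n + 1) where
  toFun F := ⟨fun g => ρ.toHom (g 0) (F.1 fun i => g i.succ)
      + ∑ j : Fin n, (-1 : ℝ) ^ ((j : ℕ) + 1) • F.1 (Fin.contractNth j.castSucc (· * ·) g)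
      + (-1 : ℝ) ^ (n + 1) • F.1 fun i => g i.castSucc, by
    have hF : ContMDiff (ModelWithCorners.pi fun _ : Fin n => 𝓘(ℝ, E)) 𝓘(ℝ, V) ∞ F.1 := F.2
    have hp := fun i : Fin (n + 1) => contMDiff_proj (E := E) (L := L) i
    refine ContMDiff.add (ContMDiff.add ?_ ?_) ?_
    · exact (ρ.smooth.comp (hp 0)).clm_apply (hF.comp (contMDiff_pi_iff.2 fun i => hp i.succ))
    · refine contMDiff_finsetSum fun j _ => ?_
      refine (contDiff_const_smul (F := V) _).contMDiff.comp (hF.comp (contMDiff_pi_iff.2 fun i => ?_))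
      unfold Fin.contractNth
      split_ifs
      · exact hp _
      · exact (hp _).mul (hp _)
      · exact hp _
    · exact (contDiff_const_smul (F := V) _).contMDiff.comp (hF.comp (contMDiff_pi_iff.2 fun i => hp i.castSucc))⟩
  map_add' F F' := by
    ext g
    simp [Finset.sum_add_distrib]
    abel
  map_smul' c F := by
    ext g
    simp [Finset.smul_sum, smul_comm c]

/-- The Van Est formula
`∑ₛ (-1)^|s| d/dt₁ ⋯ d/dtₙ F (Exp (t₁ u_{s(1)}), …, Exp (tₙ u_{s(n)}))` at `t = 0`. -/
def vanEst [FiniteDimensional ℝ E] [T2Space L] {n : ℕ} (F : (Fin n → L) → V)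
    (u : Fin n → GroupLieAlgebra 𝓘(ℝ, E) L) : V :=
  ∑ s : Equiv.Perm (Fin n), ((Equiv.Perm.sign s : ℤ) : ℝ) •
    mixedDeriv n fun t => F fun i => lieExp (t i • u (s i))

end LieGroups

section Cohomology

variable {C : ℕ → Type*} [∀ n, AddCommGroup (C n)] [∀ n, Module ℝ (C n)]

/-- The coboundaries of a sequence of maps `d : C n → C (n + 1)`. -/
def coboundaries (d : ∀ n, C n →ₗ[ℝ] C (n + 1)) : (n : ℕ) → Submodule ℝ (C n)
  | 0 => ⊥
  | n + 1 => LinearMap.range (d n)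

/-- The cohomology `ker d / im d` of a cochain complex. -/
abbrev Cohomology (d : ∀ n, C n →ₗ[ℝ] C (n + 1)) (n : ℕ) : Type _ :=
  LinearMap.ker (d n) ⧸ (coboundaries d n).comap (LinearMap.ker (d n)).subtype

/-- The cohomology class of a cocycle. -/
def Cohomology.mk (d : ∀ n, C n →ₗ[ℝ] C (n + 1)) {n : ℕ} (c : C n) (hc : d n c = 0) :
    Cohomology d n :=
  Submodule.Quotient.mk ⟨c, hc⟩

end Cohomology

section ChevalleyEilenberg

variable {V W : Type*} [AddCommGroup V] [Module ℝ V] [AddCommGroup W] [Module ℝ W]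

/-- The part of the Chevalley–Eilenberg differential that contains the bracket:
`∑_{i < j} (-1)^(i+j) f ([uᵢ, uⱼ], u₁, …, ûᵢ, …, ûⱼ, …)`. The pair `i < j` of positions is
`(i.castSucc, j.succ)` with `i ≤ j`. -/
def ceBracketSum (br : V →ₗ[ℝ] V →ₗ[ℝ] V) :
    (n : ℕ) → (V [⋀^Fin n]→ₗ[ℝ] W) → (Fin (n + 1) → V) → W
  | 0, _, _ => 0
  | n + 1, f, u => ∑ i : Fin (n + 1), ∑ j ≥ i, (-1 : ℝ) ^ ((i.castSucc : ℕ) + (j.succ : ℕ)) •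
      f (Matrix.vecCons (br (u i.castSucc) (u j.succ)) (j.removeNth (i.castSucc.removeNth u)))

theorem exists_ceBracketSum (br : V →ₗ[ℝ] V →ₗ[ℝ] V) (hbr : ∀ u, br u u = 0) (n : ℕ)
    (f : V [⋀^Fin n]→ₗ[ℝ] W) :
    ∃ f' : V [⋀^Fin (n + 1)]→ₗ[ℝ] W, ∀ u, f' u = ceBracketSum br n f u := by
  cases n with
  | zero => exact ⟨0, fun u => rfl⟩
  | succ n =>
    have hsk : ∀ u v, br v u = - br u v := fun u v => by
      have := hbr (u + v)
      simp only [map_add, LinearMap.add_apply, hbr, zero_add, add_zero] at this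
      exact eq_neg_of_add_eq_zero_left this
    refine ⟨(-(1 / 2 : ℝ)) • AlternatingMap.alternatizeUncurryFin
      (AlternatingMap.alternatizeUncurryFinLM ∘ₗ br.compr₂ f.curryLeft), fun u => ?_⟩
    rw [AlternatingMap.smul_apply,
      AlternatingMap.alternatizeUncurryFin_alternatizeUncurryFinLM_comp_apply, ceBracketSum,
      Finset.smul_sum]
    refine Finset.sum_congr rfl fun i _ => ?_
    rw [Finset.smul_sum]
    refine Finset.sum_congr rfl fun j _ => ?_
    simp only [LinearMap.compr₂_apply, hsk (u i.castSucc), map_neg, AlternatingMap.neg_apply,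
      AlternatingMap.curryLeft_apply_apply]
    rw [Fin.val_castSucc, Fin.val_succ, sub_neg_eq_add, ← two_smul ℝ, ← add_assoc, pow_succ _ (_ + _),
      ← Int.cast_smul_eq_zsmul ℝ, smul_smul, smul_smul]
    congr 1
    push_cast
    ring

/-- The Chevalley–Eilenberg formula for the differential of `f`, evaluated at `u`. -/
def ceSum (br : V →ₗ[ℝ] V →ₗ[ℝ] V) (θ : V →ₗ[ℝ] W →ₗ[ℝ] W) (n : ℕ) (f : V [⋀^Fin n]→ₗ[ℝ] W)
    (u : Fin (n + 1) → V) : W :=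
  (∑ i : Fin (n + 1), (-1 : ℝ) ^ (i : ℕ) • θ (u i) (f (i.removeNth u))) + ceBracketSum br n f u

theorem exists_ceSum (br : V →ₗ[ℝ] V →ₗ[ℝ] V) (hbr : ∀ u, br u u = 0) (θ : V →ₗ[ℝ] W →ₗ[ℝ] W)
    (n : ℕ) (f : V [⋀^Fin n]→ₗ[ℝ] W) :
    ∃ f' : V [⋀^Fin (n + 1)]→ₗ[ℝ] W, ⇑f' = ceSum br θ n f := by
  obtain ⟨f₂, h₂⟩ := exists_ceBracketSum br hbr n f
  let g : V →ₗ[ℝ] V [⋀^Fin n]→ₗ[ℝ] W :=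
    { toFun := fun v => (θ v).compAlternatingMap f
      map_add' := fun v w => by ext; simp
      map_smul' := fun c v => by ext; simp }
  refine ⟨AlternatingMap.alternatizeUncurryFin g + f₂, funext fun u => ?_⟩
  rw [AlternatingMap.add_apply, AlternatingMap.alternatizeUncurryFin_apply, h₂, ceSum]
  refine congrArg₂ _ (Finset.sum_congr rfl fun i _ => ?_) rfl
  rw [← Int.cast_smul_eq_zsmul ℝ]
  simp [g]

/-- The Chevalley–Eilenberg differential of `V` with bracket `br` and with coefficients in `W`, on
which `V` acts through `θ`. -/
def ceDifferential (br : V →ₗ[ℝ] V →ₗ[ℝ] V) (hbr : ∀ u, br u u = 0) (θ : V →ₗ[ℝ] W →ₗ[ℝ] W)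
    (n : ℕ) : (V [⋀^Fin n]→ₗ[ℝ] W) →ₗ[ℝ] (V [⋀^Fin (n + 1)]→ₗ[ℝ] W) where
  toFun f :=
    { toFun := ceSum br θ n f
      map_update_add' := by
        obtain ⟨f', h'⟩ := exists_ceSum br hbr θ n f
        rw [← h']
        exact f'.map_update_add'
      map_update_smul' := by
        obtain ⟨f', h'⟩ := exists_ceSum br hbr θ n f
        rw [← h']
        exact f'.map_update_smul'
      map_eq_zero_of_eq' := by
        obtain ⟨f', h'⟩ := exists_ceSum br hbr θ n f
        rw [← h']
        exact f'.map_eq_zero_of_eq' }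
  map_add' f f' := by
    ext u
    change ceSum br θ n (f + f') u = ceSum br θ n f u + ceSum br θ n f' u
    cases n with
    | zero => simp [ceSum, ceBracketSum]
    | succ n => simp [ceSum, ceBracketSum, Finset.sum_add_distrib]; abel
  map_smul' c f := by
    ext u
    change ceSum br θ n (c • f) u = c • ceSum br θ n f u
    cases n with
    | zero => simp [ceSum, ceBracketSum]
    | succ n => simp [ceSum, ceBracketSum, Finset.smul_sum, smul_comm c]

end ChevalleyEilenberg

section LieAlgebras

variable {𝔤 𝔥 : Type*} [LieRing 𝔤] [LieAlgebra ℝ 𝔤] [LieRing 𝔥] [LieAlgebra ℝ 𝔥]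

/-- The descendent bracket `[u, v]_B = φ(B u) v - φ(B v) u + [u, v]`. -/
def descendentBracket (φ : 𝔤 →ₗ[ℝ] 𝔥 →ₗ[ℝ] 𝔥) (B : 𝔥 →ₗ[ℝ] 𝔤) : 𝔥 →ₗ[ℝ] 𝔥 →ₗ[ℝ] 𝔥 :=
  LinearMap.mk₂ ℝ (fun u v => φ (B u) v - φ (B v) u + ⁅u, v⁆)
    (fun u u' v => by simp only [map_add, LinearMap.add_apply, add_lie]; abel)
    (fun c u v => by simp only [map_smul, LinearMap.smul_apply, smul_lie, smul_add, smul_sub])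
    (fun u v v' => by simp only [map_add, LinearMap.add_apply, lie_add]; abel)
    (fun c u v => by simp only [map_smul, LinearMap.smul_apply, lie_smul, smul_add, smul_sub])

theorem descendentBracket_self (φ : 𝔤 →ₗ[ℝ] 𝔥 →ₗ[ℝ] 𝔥) (B : 𝔥 →ₗ[ℝ] 𝔤) (u : 𝔥) :
    descendentBracket φ B u u = 0 := by
  simp [descendentBracket]

/-- The representation `θ(u) x = B (φ(x) u) + [B u, x]` of the descendent Lie algebra on `𝔤`. -/
def descendentRep (φ : 𝔤 →ₗ[ℝ] 𝔥 →ₗ[ℝ] 𝔥) (B : 𝔥 →ₗ[ℝ] 𝔤) : 𝔥 →ₗ[ℝ] 𝔤 →ₗ[ℝ] 𝔤 :=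
  LinearMap.mk₂ ℝ (fun u x => B (φ x u) + ⁅B u, x⁆)
    (fun u u' x => by simp only [map_add, add_lie]; abel)
    (fun c u x => by simp only [map_smul, smul_lie, smul_add])
    (fun u x x' => by simp only [map_add, LinearMap.add_apply, lie_add]; abel)
    (fun c u x => by simp only [map_smul, LinearMap.smul_apply, lie_smul, smul_add])

/-- The differential of the cochain complex of the relative Rota–Baxter operator `B` on a Lie
algebra: the Chevalley–Eilenberg differential of the descendent Lie algebra with coefficients
in `𝔤`. -/
def lieD (φ : 𝔤 →ₗ[ℝ] 𝔥 →ₗ[ℝ] 𝔥) (B : 𝔥 →ₗ[ℝ] 𝔤) (n : ℕ) :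
    (𝔥 [⋀^Fin n]→ₗ[ℝ] 𝔤) →ₗ[ℝ] (𝔥 [⋀^Fin (n + 1)]→ₗ[ℝ] 𝔤) :=
  ceDifferential (descendentBracket φ B) (descendentBracket_self φ B) (descendentRep φ B) n

end LieAlgebras

section RelativeRotaBaxter

variable (EG EH : Type*) [NormedAddCommGroup EG] [NormedSpace ℝ EG]
  [NormedAddCommGroup EH] [NormedSpace ℝ EH]
  (G H : Type*) [TopologicalSpace G] [ChartedSpace EG G] [Group G]
  [TopologicalSpace H] [ChartedSpace EH H] [Group H]

/-- A smooth action `Φ : G → Aut(H)` of a Lie group on a Lie group. -/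
structure LieGroupAction where
  toHom : G →* MulAut H
  smooth : ContMDiff (𝓘(ℝ, EG).prod 𝓘(ℝ, EH)) 𝓘(ℝ, EH) ∞ fun p : G × H => toHom p.1 p.2

variable {EG EH G H}

/-- A relative Rota–Baxter operator `𝓑 : H → G` with respect to the action `Φ`. -/
structure RelRotaBaxter (Φ : LieGroupAction EG EH G H) where
  toFun : H → G
  smooth : ContMDiff 𝓘(ℝ, EH) 𝓘(ℝ, EG) ∞ toFun
  mul_eq : ∀ h₁ h₂ : H, toFun h₁ * toFun h₂ = toFun (h₁ * Φ.toHom (toFun h₁) h₂)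

namespace LieGroupAction

variable (Φ : LieGroupAction EG EH G H)

theorem smooth_apply (g : G) : ContMDiff 𝓘(ℝ, EH) 𝓘(ℝ, EH) ∞ (fun h : H => Φ.toHom g h) :=
  Φ.smooth.comp (contMDiff_const.prodMk contMDiff_id)

/-- The tangent map of `Φ(g)` at the identity, an endomorphism of the Lie algebra of `H`. -/
def tangent (g : G) : EH →L[ℝ] EH :=
  mfderiv 𝓘(ℝ, EH) 𝓘(ℝ, EH) (fun h : H => Φ.toHom g h) 1

/-- The differentiated action `φ` of the Lie algebra of `G` on the Lie algebra of `H`: the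
tangent map at the identity of `g ↦ Φ.tangent g`. -/
def lieAction : GroupLieAlgebra 𝓘(ℝ, EG) G →ₗ[ℝ]
    GroupLieAlgebra 𝓘(ℝ, EH) H →ₗ[ℝ] GroupLieAlgebra 𝓘(ℝ, EH) H where
  toFun x := ((mfderiv 𝓘(ℝ, EG) 𝓘(ℝ, EH →L[ℝ] EH) Φ.tangent 1 : EG →L[ℝ] EH →L[ℝ] EH) x).toLinearMap
  map_add' x y := by
    rw [ContinuousLinearMap.map_add]; rfl
  map_smul' c x := by
    rw [ContinuousLinearMap.map_smul]; rfl

end LieGroupAction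

namespace RelRotaBaxter

variable {Φ : LieGroupAction EG EH G H} (𝓑 : RelRotaBaxter Φ)

theorem map_one : 𝓑.toFun 1 = 1 := by
  have := 𝓑.mul_eq 1 1
  simpa using this

/-- The tangent map `B` of `𝓑` at the identity. -/
def diff : GroupLieAlgebra 𝓘(ℝ, EH) H →ₗ[ℝ] GroupLieAlgebra 𝓘(ℝ, EG) G :=
  (mfderiv 𝓘(ℝ, EH) 𝓘(ℝ, EG) 𝓑.toFun 1 : EH →L[ℝ] EG).toLinearMap

/-- The descendent multiplication `h₁ ⋆ h₂ = h₁ Φ(𝓑 h₁) h₂`. -/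
def starMul (h₁ h₂ : H) : H := h₁ * Φ.toHom (𝓑.toFun h₁) h₂

/-- The descendent inverse `h† = Φ(𝓑 h)⁻¹ h⁻¹`. -/
def dag (h : H) : H := Φ.toHom (𝓑.toFun h)⁻¹ h⁻¹

theorem map_starMul (h₁ h₂ : H) : 𝓑.toFun (𝓑.starMul h₁ h₂) = 𝓑.toFun h₁ * 𝓑.toFun h₂ :=
  (𝓑.mul_eq h₁ h₂).symm

theorem map_dag (h : H) : 𝓑.toFun (𝓑.dag h) = (𝓑.toFun h)⁻¹ := by
  apply eq_inv_of_mul_eq_one_right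
  have : 𝓑.starMul h (𝓑.dag h) = 1 := by
    rw [starMul, dag, ← MulAut.mul_apply, ← map_mul]
    simp
  rw [← map_starMul, this, 𝓑.map_one]

theorem starMul_assoc (a b c : H) :
    𝓑.starMul (𝓑.starMul a b) c = 𝓑.starMul a (𝓑.starMul b c) := by
  rw [starMul, map_starMul]
  simp [starMul, mul_assoc]

theorem one_starMul (a : H) : 𝓑.starMul 1 a = a := by
  simp [starMul, 𝓑.map_one]

theorem starMul_one (a : H) : 𝓑.starMul a 1 = a := by
  simp [starMul]

theorem dag_starMul_self (a : H) : 𝓑.starMul (𝓑.dag a) a = 1 := by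
  rw [starMul, map_dag, dag, ← map_mul]
  simp

/-- The descendent Lie group: the manifold `H` with the multiplication `𝓑.star`. -/
def Descendent (_𝓑 : RelRotaBaxter Φ) : Type _ := H

instance : TopologicalSpace 𝓑.Descendent := inferInstanceAs (TopologicalSpace H)

instance : ChartedSpace EH 𝓑.Descendent := inferInstanceAs (ChartedSpace EH H)

instance [T2Space H] : T2Space 𝓑.Descendent := inferInstanceAs (T2Space H)

instance : Group 𝓑.Descendent where
  mul := 𝓑.starMul
  one := (1 : H)
  inv := 𝓑.dag
  mul_assoc := 𝓑.starMul_assoc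
  one_mul := 𝓑.one_starMul
  mul_one := 𝓑.starMul_one
  inv_mul_cancel := 𝓑.dag_starMul_self

/-- The action `Θ(h) g = 𝓑(Φ(g) h†)⁻¹ g 𝓑(h†)` of the descendent Lie group on the
manifold `G`. -/
def act (h : H) (g : G) : G :=
  (𝓑.toFun (Φ.toHom g (𝓑.dag h)))⁻¹ * g * 𝓑.toFun (𝓑.dag h)

theorem act_apply_one (h : H) : 𝓑.act h 1 = 1 := by
  simp [act]

theorem one_act (g : G) : 𝓑.act 1 g = g := by
  simp [act, dag, 𝓑.map_one]

theorem dag_starMul (h₁ h₂ : H) : 𝓑.dag (𝓑.starMul h₁ h₂) = 𝓑.starMul (𝓑.dag h₂) (𝓑.dag h₁) :=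
  mul_inv_rev (G := 𝓑.Descendent) h₁ h₂

theorem starMul_act (h₁ h₂ : H) (g : G) :
    𝓑.act (𝓑.starMul h₁ h₂) g = 𝓑.act h₁ (𝓑.act h₂ g) := by
  have key : 𝓑.toFun (Φ.toHom g (𝓑.starMul (𝓑.dag h₂) (𝓑.dag h₁))) =
      𝓑.toFun (Φ.toHom g (𝓑.dag h₂)) *
        𝓑.toFun (Φ.toHom (𝓑.act h₂ g) (𝓑.dag h₁)) := by
    rw [← map_starMul]
    simp only [starMul, act, map_mul, MulAut.mul_apply, map_inv, MulAut.apply_inv_self]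
  rw [act, dag_starMul, key, map_starMul]
  change _ = (𝓑.toFun (Φ.toHom (𝓑.act h₂ g) (𝓑.dag h₁)))⁻¹ * 𝓑.act h₂ g * 𝓑.toFun (𝓑.dag h₁)
  generalize 𝓑.toFun (Φ.toHom (𝓑.act h₂ g) (𝓑.dag h₁)) = X
  rw [act]
  group

/-- The tangent map of `Θ(h) : G → G` at the identity. -/
def tangentAct (h : H) : EG →L[ℝ] EG := mfderiv 𝓘(ℝ, EG) 𝓘(ℝ, EG) (𝓑.act h) 1

theorem tangentAct_one : 𝓑.tangentAct 1 = 1 := by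
  have h : 𝓑.act 1 = id := funext 𝓑.one_act
  rw [tangentAct, h, mfderiv_id]
  rfl

section Smooth

variable [LieGroup 𝓘(ℝ, EH) ∞ H]

theorem contMDiff_starMul : ContMDiff (𝓘(ℝ, EH).prod 𝓘(ℝ, EH)) 𝓘(ℝ, EH) ∞
    (fun p : H × H => 𝓑.starMul p.1 p.2) :=
  contMDiff_fst.mul (Φ.smooth.comp ((𝓑.smooth.comp contMDiff_fst).prodMk contMDiff_snd))

variable [LieGroup 𝓘(ℝ, EG) ∞ G]

theorem contMDiff_dag : ContMDiff 𝓘(ℝ, EH) 𝓘(ℝ, EH) ∞ 𝓑.dag :=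
  Φ.smooth.comp (𝓑.smooth.inv.prodMk contMDiff_id.inv)

instance : LieGroup 𝓘(ℝ, EH) ∞ 𝓑.Descendent where
  __ := (inferInstanceAs (IsManifold 𝓘(ℝ, EH) ∞ H) : IsManifold 𝓘(ℝ, EH) ∞ 𝓑.Descendent)
  contMDiff_mul := 𝓑.contMDiff_starMul
  contMDiff_inv := 𝓑.contMDiff_dag

theorem contMDiff_act : ContMDiff (𝓘(ℝ, EH).prod 𝓘(ℝ, EG)) 𝓘(ℝ, EG) ∞
    (fun p : H × G => 𝓑.act p.1 p.2) := by
  have h1 := 𝓑.contMDiff_dag.comp (contMDiff_fst (I := 𝓘(ℝ, EH)) (J := 𝓘(ℝ, EG)) (M := H) (N := G))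
  exact (((𝓑.smooth.comp (Φ.smooth.comp (contMDiff_snd.prodMk h1))).inv).mul contMDiff_snd).mul
    (𝓑.smooth.comp h1)

theorem contMDiff_tangentAct :
    ContMDiff 𝓘(ℝ, EH) 𝓘(ℝ, EG →L[ℝ] EG) ∞ 𝓑.tangentAct := by
  intro h
  have h1 := ContMDiffAt.mfderiv (m := ∞) (n := ∞) (I := 𝓘(ℝ, EG)) (I' := 𝓘(ℝ, EG))
    (J := 𝓘(ℝ, EH)) (x₀ := h) 𝓑.act (fun _ => (1 : G))
    𝓑.contMDiff_act.contMDiffAt contMDiffAt_const (by simp)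
  have h2 := (congrArg (fun f : H → G => ContMDiffAt 𝓘(ℝ, EH) 𝓘(ℝ, EG →L[ℝ] EG) ∞
    (inTangentCoordinates 𝓘(ℝ, EG) 𝓘(ℝ, EG) (fun _ : H => (1 : G)) f 𝓑.tangentAct h) h)
    (funext 𝓑.act_apply_one : (fun x : H => 𝓑.act x 1) = fun _ => 1)).mp h1
  refine ContMDiffAt.congr_of_eventuallyEq h2 (Filter.Eventually.of_forall fun x => ?_)
  have h3 := inTangentCoordinates_eq (I := 𝓘(ℝ, EG)) (I' := 𝓘(ℝ, EG)) (fun _ : H => (1 : G))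
    (fun _ : H => (1 : G)) 𝓑.tangentAct (x₀ := h) (x := x)
    (mem_chart_source EG (1 : G)) (mem_chart_source EG (1 : G))
  rw [h3]
  ext v
  simp only [ContinuousLinearMap.comp_apply]
  rw [(tangentBundleCore 𝓘(ℝ, EG) G).coordChange_self _ _ (mem_chart_source EG (1 : G)),
    (tangentBundleCore 𝓘(ℝ, EG) G).coordChange_self _ _ (mem_chart_source EG (1 : G))]

theorem tangentAct_starMul (h₁ h₂ : H) :
    𝓑.tangentAct (𝓑.starMul h₁ h₂) = 𝓑.tangentAct h₁ * 𝓑.tangentAct h₂ := by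
  have hs : ∀ (h : H) (g : G), MDifferentiableAt 𝓘(ℝ, EG) 𝓘(ℝ, EG) (𝓑.act h) g := fun h g =>
    (𝓑.contMDiff_act.comp (contMDiff_const.prodMk contMDiff_id)).mdifferentiableAt (by simp)
  have h : 𝓑.act (𝓑.starMul h₁ h₂) = 𝓑.act h₁ ∘ 𝓑.act h₂ := funext (𝓑.starMul_act h₁ h₂)
  have key : ∀ y : G, y = 1 →
      ((mfderiv 𝓘(ℝ, EG) 𝓘(ℝ, EG) (𝓑.act h₁) y : EG →L[ℝ] EG).comp
        (𝓑.tangentAct h₂)) = (𝓑.tangentAct h₁).comp (𝓑.tangentAct h₂) := by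
    rintro _ rfl
    rfl
  rw [tangentAct, h, mfderiv_comp_of_eq (hs h₁ 1) (hs h₂ 1) (𝓑.act_apply_one h₂)]
  exact key _ (𝓑.act_apply_one h₂)

/-- The representation `Θ` of the descendent Lie group on the Lie algebra of `G`, by the tangent
maps of `Θ(h) : G → G` at the identity. -/
def rep : SmoothRep EH 𝓑.Descendent EG where
  toHom :=
    { toFun := 𝓑.tangentAct
      map_one' := 𝓑.tangentAct_one
      map_mul' := 𝓑.tangentAct_starMul }
  smooth := 𝓑.contMDiff_tangentAct

end Smooth

variable [LieGroup 𝓘(ℝ, EH) ∞ H] [FiniteDimensional ℝ EH] [T2Space H]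

/-- The Van Est map on a smooth cochain `F` of the descendent Lie group with values in the Lie
algebra of `G`, with `Exp` the exponential map of the descendent Lie group (whose tangent space at
the identity is that of `H`). -/
def vanEst [LieGroup 𝓘(ℝ, EG) ∞ G] {n : ℕ} (F : SmoothCochain EH 𝓑.Descendent EG n)
    (u : Fin n → GroupLieAlgebra 𝓘(ℝ, EH) H) : GroupLieAlgebra 𝓘(ℝ, EG) G :=
  RotaBaxter.vanEst (V := EG) F.1 (show Fin n → GroupLieAlgebra 𝓘(ℝ, EH) 𝓑.Descendent from u)

end RelRotaBaxter

end RelativeRotaBaxter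

end RotaBaxter

end

open RotaBaxter

/-!
The Van Est map only sees a cochain `F` near the identity, and only its mixed derivative
`D₁ ⋯ Dₙ F`, once in each variable. In the chart at the identity of the descendent group this is a
multilinear map, `mixedFDeriv`, and since `t ↦ Exp(t u)` has velocity `u` at `0`, the Van Est
formula is the alternation of this multilinear map (`vanEst_eq_altSum`). This gives the values in
alternating maps and the linearity in `F`.

For the differential, take the mixed derivative of each term of `d F` (`altSum_mixedFDeriv_d`). The
last term does not depend on the last variable and vanishes. The first term becomes the derivative
of the representation at the identity, applied to the mixed derivative of `F`; alternation turns it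
into the sum over `θ(uᵢ)` (`altSum_succ`). In a term with `hᵢ ⋆ hᵢ₊₁`, the second derivative of `F`
in the direction of the product is symmetric in the two arguments and is killed by alternation.
What remains is the mixed second derivative of the multiplication, and its skew-symmetrization is
the Lie bracket of the group (`mixedFDeriv_contractNth_sub_swap`, `lie_eq_skewSnd_chartMul`). The
combinatorial identity `sum_altSum_contractNth` collects these terms into the bracket part of the
Chevalley–Eilenberg differential.

It remains to see that the infinitesimal data of the descendent group are those of the descendent
Lie algebra. The bracket is read off from the second-order expansion of `h₁ ⋆ h₂` in
`RelRotaBaxter.descendentBracket_eq_skewSnd`. For the representation, both sides of the identity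
`𝓑(Φ(g) h†) · Θ(h)(g) = g · 𝓑(h†)` are expanded to second order by the product rule
`fderiv_fderiv_oneChart_mul`, and the part that is bilinear in `h` and `g` is
`θ(u) x = B(φ(x) u) + [B u, x]` (`RelRotaBaxter.fderiv_tangentAct`).

The statement about cohomology is formal (`exists_cohomology_map`).
-/

noncomputable section

namespace RotaBaxter

/-! ### Mixed derivatives of functions of several vector variables -/

section MixedDerivatives

universe u v w

variable {E : Type u} [NormedAddCommGroup E] [NormedSpace ℝ E]
  {P : Type u} [NormedAddCommGroup P] [NormedSpace ℝ P]
  {V : Type v} [NormedAddCommGroup V] [NormedSpace ℝ V]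
  {V' : Type w} [NormedAddCommGroup V'] [NormedSpace ℝ V']

/-- The mixed derivative of `f : Eⁿ → V` at the diagonal point `(x₀, …, x₀)`, once in each of the
`n` variables, as a continuous multilinear map. The first variable is differentiated last. -/
def mixedFDeriv (x₀ : E) : (n : ℕ) → ((Fin n → E) → V) → E [×n]→L[ℝ] V
  | 0, f => (continuousMultilinearCurryFin0 ℝ E V).symm (f Fin.elim0)
  | n + 1, f => (continuousMultilinearCurryLeftEquiv ℝ (fun _ : Fin (n + 1) => E) V).symm
      (fderiv ℝ (fun x => mixedFDeriv x₀ n fun y => f (Fin.cons x y)) x₀)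

theorem mixedFDeriv_succ_apply (x₀ : E) {n : ℕ} (f : (Fin (n + 1) → E) → V) (u : Fin (n + 1) → E) :
    mixedFDeriv x₀ (n + 1) f u =
      fderiv ℝ (fun x => mixedFDeriv x₀ n fun y => f (Fin.cons x y)) x₀ (u 0) (Fin.tail u) := rfl

variable {x₀ : E} {U : Set E}

theorem cons_mem_pi {α : Type*} {U : Set α} {n : ℕ} {x : α} {y : Fin n → α} (hx : x ∈ U)
    (hy : y ∈ Set.univ.pi fun _ => U) :
    (Fin.cons x y : Fin (n + 1) → α) ∈ Set.univ.pi fun _ => U := by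
  intro i _
  cases i using Fin.cases with
  | zero => exact hx
  | succ i => exact hy i trivial

theorem contDiff_finCons {n : ℕ} :
    ContDiff ℝ ∞ (fun p : E × (Fin n → E) => (Fin.cons p.1 p.2 : Fin (n + 1) → E)) := by
  rw [contDiff_pi]
  intro i
  cases i using Fin.cases with
  | zero => exact contDiff_fst
  | succ i => exact (contDiff_apply ℝ E i).comp contDiff_snd

/-- The mixed derivative depends smoothly on parameters. The parameter space is in the universe of
`E`, since the induction on `n` replaces `P` by `P × E`. -/
theorem contDiffOn_mixedFDeriv (hU : IsOpen U) (hx₀ : x₀ ∈ U) {Ω : Set P} (hΩ : IsOpen Ω) {n : ℕ}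
    {F : P → (Fin n → E) → V}
    (hF : ContDiffOn ℝ ∞ (fun q : P × (Fin n → E) => F q.1 q.2)
      (Ω ×ˢ Set.univ.pi fun _ => U)) :
    ContDiffOn ℝ ∞ (fun p => mixedFDeriv x₀ n (F p)) Ω := by
  induction n generalizing P with
  | zero =>
    refine (continuousMultilinearCurryFin0 ℝ E V).symm.contDiff.comp_contDiffOn ?_
    exact hF.comp (contDiff_id.prodMk contDiff_const).contDiffOn fun p hp => ⟨hp, fun i => i.elim0⟩
  | succ n ih =>
    have hA : ContDiff ℝ ∞ (continuousMultilinearCurryLeftEquiv ℝ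
        (fun _ : Fin (n + 1) => E) V).symm :=
      LinearIsometryEquiv.contDiff (𝕜 := ℝ) (E := E →L[ℝ] E [×n]→L[ℝ] V)
        (F := E [×(n + 1)]→L[ℝ] V) _
    refine hA.comp_contDiffOn ?_
    have h1 : ContDiffOn ℝ ∞ (fun q : P × E => mixedFDeriv x₀ n fun y => F q.1 (Fin.cons q.2 y))
        (Ω ×ˢ U) := by
      refine ih (hΩ.prod hU) (F := fun q y => F q.1 (Fin.cons q.2 y)) ?_
      refine hF.comp (s := (Ω ×ˢ U) ×ˢ Set.univ.pi fun _ => U)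
        (g := fun q : P × (Fin (n + 1) → E) => F q.1 q.2)
        (f := fun q : (P × E) × (Fin n → E) => (q.1.1, (Fin.cons q.1.2 q.2 : Fin (n + 1) → E)))
        ?_ ?_
      · exact ((contDiff_fst.comp contDiff_fst).prodMk (contDiff_finCons.comp
          ((contDiff_snd.comp contDiff_fst).prodMk contDiff_snd))).contDiffOn
      · rintro ⟨⟨p, x⟩, y⟩ ⟨⟨hp, hx⟩, hy⟩
        exact ⟨hp, cons_mem_pi hx hy⟩
    intro p hp
    refine ContDiffAt.contDiffWithinAt ?_
    refine ContDiffAt.fderiv (n := ∞) (g := fun _ => x₀)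
      (f := fun p x => mixedFDeriv x₀ n fun y => F p (Fin.cons x y)) ?_ contDiffAt_const (by simp)
    exact h1.contDiffAt ((hΩ.prod hU).mem_nhds ⟨hp, hx₀⟩)

theorem contDiffOn_cons_right {n : ℕ} {f : (Fin (n + 1) → E) → V}
    (hf : ContDiffOn ℝ ∞ f (Set.univ.pi fun _ => U)) {x : E} (hx : x ∈ U) :
    ContDiffOn ℝ ∞ (fun y : Fin n → E => f (Fin.cons x y)) (Set.univ.pi fun _ => U) :=
  hf.comp (contDiff_finCons.comp (contDiff_const.prodMk contDiff_id)).contDiffOn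
    fun _ hy => cons_mem_pi hx hy

theorem contDiffOn_mixedFDeriv_cons (hU : IsOpen U) (hx₀ : x₀ ∈ U) {n : ℕ}
    {f : (Fin (n + 1) → E) → V} (hf : ContDiffOn ℝ ∞ f (Set.univ.pi fun _ => U)) :
    ContDiffOn ℝ ∞ (fun x => mixedFDeriv x₀ n fun y => f (Fin.cons x y)) U :=
  contDiffOn_mixedFDeriv hU hx₀ hU
    (hf.comp contDiff_finCons.contDiffOn fun _ hq => cons_mem_pi hq.1 hq.2)

theorem differentiableAt_mixedFDeriv_cons (hU : IsOpen U) (hx₀ : x₀ ∈ U) {n : ℕ}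
    {f : (Fin (n + 1) → E) → V} (hf : ContDiffOn ℝ ∞ f (Set.univ.pi fun _ => U)) {x : E}
    (hx : x ∈ U) :
    DifferentiableAt ℝ (fun x => mixedFDeriv x₀ n fun y => f (Fin.cons x y)) x :=
  ((contDiffOn_mixedFDeriv_cons hU hx₀ hf).contDiffAt (hU.mem_nhds hx)).differentiableAt (by simp)

theorem fderiv_mixedFDeriv_apply {Q : Type*} [NormedAddCommGroup Q] [NormedSpace ℝ Q] {n : ℕ}
    {N : Q → E [×n]→L[ℝ] V} {x : Q} (hN : DifferentiableAt ℝ N x)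
    (a : Q) (u : Fin n → E) :
    fderiv ℝ N x a u = fderiv ℝ (fun x => N x u) x a := by
  have := (ContinuousMultilinearMap.apply ℝ (fun _ : Fin n => E) V u).hasFDerivAt.comp x
    hN.hasFDerivAt
  have h2 := this.fderiv
  change fderiv ℝ (fun x => N x u) x = _ at h2
  rw [h2]
  rfl

theorem mixedFDeriv_succ_apply' (hU : IsOpen U) (hx₀ : x₀ ∈ U) {n : ℕ}
    {f : (Fin (n + 1) → E) → V} (hf : ContDiffOn ℝ ∞ f (Set.univ.pi fun _ => U))
    (u : Fin (n + 1) → E) :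
    mixedFDeriv x₀ (n + 1) f u =
      fderiv ℝ (fun x => mixedFDeriv x₀ n (fun y => f (Fin.cons x y)) (Fin.tail u)) x₀ (u 0) := by
  rw [mixedFDeriv_succ_apply,
    fderiv_mixedFDeriv_apply (differentiableAt_mixedFDeriv_cons hU hx₀ hf hx₀)]

theorem mixedFDeriv_congr (hU : IsOpen U) (hx₀ : x₀ ∈ U) {n : ℕ} {f f' : (Fin n → E) → V}
    (h : Set.EqOn f f' (Set.univ.pi fun _ => U)) :
    mixedFDeriv x₀ n f = mixedFDeriv x₀ n f' := by
  induction n with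
  | zero =>
    exact congrArg (continuousMultilinearCurryFin0 ℝ E V).symm (h fun i => i.elim0)
  | succ n ih =>
    refine congrArg (continuousMultilinearCurryLeftEquiv ℝ (fun _ : Fin (n + 1) => E) V).symm
      (Filter.EventuallyEq.fderiv_eq ?_)
    filter_upwards [hU.mem_nhds hx₀] with x hx
    exact ih fun y hy => h (cons_mem_pi hx hy)

/-- The mixed derivative commutes with continuous linear maps. Additivity and homogeneity are special
cases, for the linear maps `V × V → V` and `V → V` in question. -/
theorem mixedFDeriv_clm_comp (hU : IsOpen U) (hx₀ : x₀ ∈ U) (A : V →L[ℝ] V') {n : ℕ}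
    {f : (Fin n → E) → V} (hf : ContDiffOn ℝ ∞ f (Set.univ.pi fun _ => U)) :
    mixedFDeriv x₀ n (fun y => A (f y)) = A.compContinuousMultilinearMap (mixedFDeriv x₀ n f) := by
  induction n with
  | zero => ext u; rfl
  | succ n ih =>
    have h1 : (fun x => mixedFDeriv x₀ n fun y => A (f (Fin.cons x y))) =ᶠ[nhds x₀]
        fun x => ContinuousLinearMap.compContinuousMultilinearMapL ℝ (fun _ : Fin n => E) V V' A
          (mixedFDeriv x₀ n fun y => f (Fin.cons x y)) := by
      filter_upwards [hU.mem_nhds hx₀] with x hx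
      exact ih (contDiffOn_cons_right hf hx)
    have h2 := (ContinuousLinearMap.compContinuousMultilinearMapL ℝ (fun _ : Fin n => E) V V'
      A).hasFDerivAt.comp x₀ (differentiableAt_mixedFDeriv_cons hU hx₀ hf hx₀).hasFDerivAt
    ext u
    rw [mixedFDeriv_succ_apply, h1.fderiv_eq]
    erw [h2.fderiv]
    rfl

theorem mixedFDeriv_add (hU : IsOpen U) (hx₀ : x₀ ∈ U) {n : ℕ} {f f' : (Fin n → E) → V}
    (hf : ContDiffOn ℝ ∞ f (Set.univ.pi fun _ => U))
    (hf' : ContDiffOn ℝ ∞ f' (Set.univ.pi fun _ => U)) :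
    mixedFDeriv x₀ n (fun y => f y + f' y) = mixedFDeriv x₀ n f + mixedFDeriv x₀ n f' := by
  have h := hf.prodMk hf'
  have h1 := mixedFDeriv_clm_comp hU hx₀ (ContinuousLinearMap.fst ℝ V V) h
  have h2 := mixedFDeriv_clm_comp hU hx₀ (ContinuousLinearMap.snd ℝ V V) h
  have h3 := mixedFDeriv_clm_comp hU hx₀
    (ContinuousLinearMap.fst ℝ V V + ContinuousLinearMap.snd ℝ V V) h
  ext u
  exact (congrArg (fun m => m u) h3).trans
    (congrArg₂ (· + ·) (congrArg (fun m => m u) h1.symm) (congrArg (fun m => m u) h2.symm))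

theorem mixedFDeriv_smul (hU : IsOpen U) (hx₀ : x₀ ∈ U) {n : ℕ} (c : ℝ) {f : (Fin n → E) → V}
    (hf : ContDiffOn ℝ ∞ f (Set.univ.pi fun _ => U)) :
    mixedFDeriv x₀ n (fun y => c • f y) = c • mixedFDeriv x₀ n f :=
  mixedFDeriv_clm_comp hU hx₀ (c • ContinuousLinearMap.id ℝ V) hf

theorem mixedFDeriv_sum (hU : IsOpen U) (hx₀ : x₀ ∈ U) {n : ℕ} {ι : Type*} (s : Finset ι)
    {f : ι → (Fin n → E) → V} (hf : ∀ i, ContDiffOn ℝ ∞ (f i) (Set.univ.pi fun _ => U)) :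
    mixedFDeriv x₀ n (fun y => ∑ i ∈ s, f i y) = ∑ i ∈ s, mixedFDeriv x₀ n (f i) := by
  classical
  induction s using Finset.induction_on with
  | empty =>
    have := mixedFDeriv_smul (V := V) (n := n) hU hx₀ 0 (f := fun _ => 0) contDiffOn_const
    simpa using this
  | insert a s ha ih =>
    rw [Finset.sum_insert ha, ← ih,
      ← mixedFDeriv_add hU hx₀ (hf a) (ContDiffOn.sum fun i _ => hf i)]
    simp_rw [Finset.sum_insert ha]

/-- The mixed derivative of a function that does not depend on its last variable vanishes. -/
theorem mixedFDeriv_init (x₀ : E) {n : ℕ} (f : (Fin n → E) → V) :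
    mixedFDeriv x₀ (n + 1) (fun y => f fun i => y i.castSucc) = 0 := by
  induction n with
  | zero =>
    ext u
    rw [mixedFDeriv_succ_apply]
    have : (fun x : E => mixedFDeriv x₀ 0 fun y : Fin 0 → E => f fun i =>
        (Fin.cons x y : Fin 1 → E) i.castSucc) = fun _ => mixedFDeriv x₀ 0 f := by
      funext x
      ext u
      exact congrArg f (funext fun i => i.elim0)
    rw [this]
    simp
  | succ n ih =>
    have h : (fun x : E => mixedFDeriv x₀ (n + 1) fun y : Fin (n + 1) → E => f fun i =>
        (Fin.cons x y : Fin (n + 2) → E) i.castSucc) = fun _ => 0 := by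
      funext x
      rw [← ih fun z => f (Fin.cons x z)]
      refine congrArg _ (funext fun y => congrArg f (funext fun i => ?_))
      cases i using Fin.cases <;> rfl
    ext u
    rw [mixedFDeriv_succ_apply, h]
    simp

/-- A mixed derivative along curves only depends on the velocities of the curves. -/
theorem mixedDeriv_comp_curves (hU : IsOpen U) (hx₀ : x₀ ∈ U) {n : ℕ} {f : (Fin n → E) → V}
    (hf : ContDiffOn ℝ ∞ f (Set.univ.pi fun _ => U)) {c : Fin n → ℝ → E} {u : Fin n → E}
    (hc0 : ∀ i, c i 0 = x₀) (hc : ∀ i, HasDerivAt (c i) (u i) 0) :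
    mixedDeriv n (fun t => f fun i => c i (t i)) = mixedFDeriv x₀ n f u := by
  induction n with
  | zero => exact congrArg f (funext fun i => i.elim0)
  | succ n ih =>
    have h1 : (fun t : ℝ => mixedDeriv n fun τ => f fun i =>
        c i ((Fin.cons t τ : Fin (n + 1) → ℝ) i)) =ᶠ[nhds 0] fun t =>
          mixedFDeriv x₀ n (fun y => f (Fin.cons (c 0 t) y)) (Fin.tail u) := by
      have hn : U ∈ nhds (c 0 0) := by rw [hc0]; exact hU.mem_nhds hx₀
      filter_upwards [(hc 0).continuousAt.preimage_mem_nhds hn] with t ht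
      rw [← ih (c := fun i => c i.succ) (u := Fin.tail u) (contDiffOn_cons_right hf ht) (fun i => hc0 _)
        fun i => hc _]
      refine congrArg _ (funext fun τ => congrArg f (funext fun i => ?_))
      cases i using Fin.cases <;> rfl
    rw [mixedDeriv, h1.deriv_eq, mixedFDeriv_succ_apply' hU hx₀ hf]
    have h2 : DifferentiableAt ℝ (fun x => mixedFDeriv x₀ n (fun y => f (Fin.cons x y))
        (Fin.tail u)) (c 0 0) := by
      rw [hc0]
      exact (ContinuousMultilinearMap.apply ℝ (fun _ : Fin n => E) V
        (Fin.tail u)).differentiableAt.comp _ (differentiableAt_mixedFDeriv_cons hU hx₀ hf hx₀)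
    have h3 := (h2.hasFDerivAt.comp_hasDerivAt (0 : ℝ) (hc 0)).deriv
    rw [hc0] at h3
    exact h3

end MixedDerivatives

/-! ### Second derivatives of compositions -/

section SecondDerivatives

variable {E₁ E₂ E F : Type*} [NormedAddCommGroup E₁] [NormedSpace ℝ E₁]
  [NormedAddCommGroup E₂] [NormedSpace ℝ E₂] [NormedAddCommGroup E] [NormedSpace ℝ E]
  [NormedAddCommGroup F] [NormedSpace ℝ F]

theorem eventually_differentiableAt {f : E → F} {p : E} (hf : ContDiffAt ℝ 2 f p) :
    ∀ᶠ x in nhds p, DifferentiableAt ℝ f x := by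
  filter_upwards [hf.eventually (by simp)] with x hx
  exact hx.differentiableAt (by simp)

theorem differentiableAt_fderiv {f : E → F} {p : E} (hf : ContDiffAt ℝ 2 f p) :
    DifferentiableAt ℝ (fderiv ℝ f) p :=
  (hf.fderiv_right (m := 1) (by norm_num)).differentiableAt (by simp)

theorem fderiv_fderiv_symm {f : E → F} {p : E} (hf : ContDiffAt ℝ 2 f p) (v w : E) :
    fderiv ℝ (fderiv ℝ f) p v w = fderiv ℝ (fderiv ℝ f) p w v :=
  hf.isSymmSndFDerivAt (by simp) v w

theorem fderiv_fderiv_partial_apply {f : E₁ × E₂ → F} {p : E₁} {q : E₂}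
    (hf : ContDiffAt ℝ 2 f (p, q)) (a : E₁) (b : E₂) :
    fderiv ℝ (fun x => fderiv ℝ (fun y => f (x, y)) q b) p a =
      fderiv ℝ (fderiv ℝ f) (p, q) (a, 0) (0, b) := by
  have hi : HasFDerivAt (fun x : E₁ => (x, q)) (ContinuousLinearMap.inl ℝ E₁ E₂) p :=
    hasFDerivAt_prodMk_left p q
  have h1 : (fun x => fderiv ℝ (fun y => f (x, y)) q b) =ᶠ[nhds p] fun x =>
      fderiv ℝ f (x, q) (0, b) := by
    filter_upwards [hi.continuousAt.eventually (eventually_differentiableAt hf)] with x hx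
    have h := (hx.hasFDerivAt.comp q (hasFDerivAt_prodMk_right x q)).fderiv
    exact congrArg (fun A : E₂ →L[ℝ] F => A b) h
  have h2 : HasFDerivAt (fun x => fderiv ℝ f (x, q))
      ((fderiv ℝ (fderiv ℝ f) (p, q)).comp (ContinuousLinearMap.inl ℝ E₁ E₂)) p :=
    (differentiableAt_fderiv hf).hasFDerivAt.comp p hi
  rw [h1.fderiv_eq, (h2.clm_apply (hasFDerivAt_const ((0, b) : E₁ × E₂) p)).fderiv]
  simp

theorem fderiv_fderiv_partial_apply' {f : E₁ × E₂ → F} {p : E₁} {q : E₂}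
    (hf : ContDiffAt ℝ 2 f (p, q)) (a : E₁) (b : E₂) :
    fderiv ℝ (fun y => fderiv ℝ (fun x => f (x, y)) p a) q b =
      fderiv ℝ (fderiv ℝ f) (p, q) (a, 0) (0, b) := by
  have hi : HasFDerivAt (fun y : E₂ => (p, y)) (ContinuousLinearMap.inr ℝ E₁ E₂) q :=
    hasFDerivAt_prodMk_right p q
  have h1 : (fun y => fderiv ℝ (fun x => f (x, y)) p a) =ᶠ[nhds q] fun y =>
      fderiv ℝ f (p, y) (a, 0) := by
    filter_upwards [hi.continuousAt.eventually (eventually_differentiableAt hf)] with y hy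
    have h := (HasFDerivAt.comp (f := fun x => (x, y)) p hy.hasFDerivAt
      (hasFDerivAt_prodMk_left p y)).fderiv
    exact congrArg (fun A : E₁ →L[ℝ] F => A a) h
  have h2 : HasFDerivAt (fun y => fderiv ℝ f (p, y))
      ((fderiv ℝ (fderiv ℝ f) (p, q)).comp (ContinuousLinearMap.inr ℝ E₁ E₂)) q :=
    HasFDerivAt.comp (f := fun y => (p, y)) q (differentiableAt_fderiv hf).hasFDerivAt hi
  rw [h1.fderiv_eq, (h2.clm_apply (hasFDerivAt_const ((a, 0) : E₁ × E₂) q)).fderiv,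
    fderiv_fderiv_symm hf]
  simp

theorem fderiv_fderiv_comp {f : E → F} {g : E₁ → E} {p : E₁} (hf : ContDiffAt ℝ 2 f (g p))
    (hg : ContDiffAt ℝ 2 g p) (v w : E₁) :
    fderiv ℝ (fderiv ℝ fun x => f (g x)) p v w =
      fderiv ℝ (fderiv ℝ f) (g p) (fderiv ℝ g p v) (fderiv ℝ g p w) +
        fderiv ℝ f (g p) (fderiv ℝ (fderiv ℝ g) p v w) := by
  have h1 : (fderiv ℝ fun x => f (g x)) =ᶠ[nhds p] fun x =>
      (fderiv ℝ f (g x)).comp (fderiv ℝ g x) := by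
    filter_upwards [hg.continuousAt.eventually (eventually_differentiableAt hf),
      eventually_differentiableAt hg] with x hx hx'
    exact fderiv_comp x hx hx'
  have h2 : HasFDerivAt (fun x => fderiv ℝ f (g x))
      ((fderiv ℝ (fderiv ℝ f) (g p)).comp (fderiv ℝ g p)) p :=
    (differentiableAt_fderiv hf).hasFDerivAt.comp p
      (hg.differentiableAt (by simp)).hasFDerivAt
  rw [h1.fderiv_eq, (h2.clm_comp (differentiableAt_fderiv hg).hasFDerivAt).fderiv]
  simp [add_comm]

/-- A map `m` with `m x x₀ = x` and `m x₀ y = y` behaves to first order at `(x₀, x₀)` like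
addition. -/
theorem fderiv_localMul {m : E × E → E} {x₀ : E} (hm : ContDiffAt ℝ 2 m (x₀, x₀))
    (hl : ∀ᶠ x in nhds x₀, m (x, x₀) = x) (hr : ∀ᶠ y in nhds x₀, m (x₀, y) = y) (v : E × E) :
    fderiv ℝ m (x₀, x₀) v = v.1 + v.2 := by
  have hd := (hm.differentiableAt (by simp)).hasFDerivAt
  have h1 := HasFDerivAt.comp (f := fun x => (x, x₀)) x₀ hd (hasFDerivAt_prodMk_left x₀ x₀)
  have h2 := HasFDerivAt.comp (f := fun y => (x₀, y)) x₀ hd (hasFDerivAt_prodMk_right x₀ x₀)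
  have h1' : HasFDerivAt (fun x => m (x, x₀)) (ContinuousLinearMap.id ℝ E) x₀ :=
    (hasFDerivAt_id x₀).congr_of_eventuallyEq hl
  have h2' : HasFDerivAt (fun x => m (x₀, x)) (ContinuousLinearMap.id ℝ E) x₀ :=
    (hasFDerivAt_id x₀).congr_of_eventuallyEq hr
  have e1 := congrArg (fun A : E →L[ℝ] E => A v.1) (h1.unique h1')
  have e2 := congrArg (fun A : E →L[ℝ] E => A v.2) (h2.unique h2')
  have : v = (v.1, 0) + (0, v.2) := by simp
  rw [this, map_add]
  simpa using congrArg₂ (· + ·) e1 e2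

/-- The second derivative at `(x₀, x₀)` of a map `m` with `m x x₀ = x` and `m x₀ y = y` is
determined by its mixed part. -/
theorem fderiv_fderiv_localMul {m : E × E → E} {x₀ : E} (hm : ContDiffAt ℝ 2 m (x₀, x₀))
    (hl : ∀ᶠ x in nhds x₀, m (x, x₀) = x) (hr : ∀ᶠ y in nhds x₀, m (x₀, y) = y) (v w : E × E) :
    fderiv ℝ (fderiv ℝ m) (x₀, x₀) v w =
      fderiv ℝ (fderiv ℝ m) (x₀, x₀) (v.1, 0) (0, w.2) +
        fderiv ℝ (fderiv ℝ m) (x₀, x₀) (w.1, 0) (0, v.2) := by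
  have hid : ∀ f : E → E, f =ᶠ[nhds x₀] (fun x => x) → fderiv ℝ (fderiv ℝ f) x₀ = 0 := by
    intro f hf
    rw [hf.fderiv.fderiv_eq]
    have : fderiv ℝ (fun x : E => x) = fun _ => ContinuousLinearMap.id ℝ E := by
      funext x; exact fderiv_fun_id
    rw [this]; simp
  have h1 : fderiv ℝ (fderiv ℝ m) (x₀, x₀) (v.1, 0) (w.1, 0) = 0 := by
    have := fderiv_fderiv_comp (f := m) (g := fun x : E => (x, x₀)) (p := x₀) hm
      (contDiff_id.prodMk contDiff_const).contDiffAt v.1 w.1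
    rw [hid _ hl] at this
    have hg : fderiv ℝ (fun x : E => (x, x₀)) = fun _ => ContinuousLinearMap.inl ℝ E E :=
      funext fun x => (hasFDerivAt_prodMk_left x x₀).fderiv
    rw [hg] at this
    simpa using this.symm
  have h2 : fderiv ℝ (fderiv ℝ m) (x₀, x₀) (0, v.2) (0, w.2) = 0 := by
    have := fderiv_fderiv_comp (f := m) (g := fun x : E => (x₀, x)) (p := x₀) hm
      (contDiff_const.prodMk contDiff_id).contDiffAt v.2 w.2
    rw [hid _ hr] at this
    have hg : fderiv ℝ (fun x : E => (x₀, x)) = fun _ => ContinuousLinearMap.inr ℝ E E :=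
      funext fun x => (hasFDerivAt_prodMk_right x₀ x).fderiv
    rw [hg] at this
    simpa using this.symm
  have e : ∀ z : E × E, z = (z.1, 0) + (0, z.2) := fun z => by simp
  calc fderiv ℝ (fderiv ℝ m) (x₀, x₀) v w
      = fderiv ℝ (fderiv ℝ m) (x₀, x₀) ((v.1, 0) + (0, v.2)) ((w.1, 0) + (0, w.2)) := by
        rw [← e, ← e]
    _ = _ := by
        rw [map_add (fderiv ℝ (fderiv ℝ m) (x₀, x₀)), add_apply, map_add, map_add, h1, h2,
          fderiv_fderiv_symm hm (0, v.2)]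
        abel

end SecondDerivatives

/-! ### Mixed derivatives and contraction of neighbouring variables -/

section Contraction

universe u v
variable {E : Type u} [NormedAddCommGroup E] [NormedSpace ℝ E]
  {V : Type v} [NormedAddCommGroup V] [NormedSpace ℝ V]

theorem contractNth_zero_cons {α : Type*} (m : α → α → α) {n : ℕ} (x y : α) (z : Fin n → α) :
    Fin.contractNth (0 : Fin (n + 1)).castSucc m (Fin.cons x (Fin.cons y z : Fin (n + 1) → α)) =
      Fin.cons (m x y) z := by
  funext k
  cases k using Fin.cases with
  | zero => simp [Fin.contractNth]
  | succ k => simp [Fin.contractNth]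

theorem contractNth_succ_cons {α : Type*} (m : α → α → α) {n : ℕ} (j : Fin n) (x : α)
    (y : Fin (n + 1) → α) :
    Fin.contractNth j.succ.castSucc m (Fin.cons x y : Fin (n + 2) → α) =
      Fin.cons x (Fin.contractNth j.castSucc m y) := by
  funext k
  cases k using Fin.cases with
  | zero => simp [Fin.contractNth]
  | succ k =>
    simp only [Fin.contractNth, Fin.val_castSucc, Fin.val_succ, add_lt_add_iff_right,
      add_left_inj, Fin.cons_succ]
    rfl

/-- The skew-symmetrization of the mixed second derivative at `(x₀, x₀)`. For the multiplication of
a Lie group in a chart at the identity this is the Lie bracket. -/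
def skewSnd (m : E × E → E) (x₀ : E) (a b : E) : E :=
  fderiv ℝ (fderiv ℝ m) (x₀, x₀) (a, 0) (0, b) - fderiv ℝ (fderiv ℝ m) (x₀, x₀) (b, 0) (0, a)

variable {x₀ : E} {U W : Set E} {m : E × E → E}

theorem contDiffOn_contractNth (hm : ContDiffOn ℝ ∞ m (W ×ˢ W))
    (hmU : ∀ x ∈ W, ∀ y ∈ W, m (x, y) ∈ U) (hWU : W ⊆ U) {n : ℕ} (j : Fin (n + 1))
    {f : (Fin n → E) → V} (hf : ContDiffOn ℝ ∞ f (Set.univ.pi fun _ => U)) :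
    ContDiffOn ℝ ∞ (fun y : Fin (n + 1) → E => f (Fin.contractNth j (fun x y => m (x, y)) y))
      (Set.univ.pi fun _ => W) := by
  refine hf.comp (contDiffOn_pi.2 fun k => ?_) fun y hy k _ => ?_
  · unfold Fin.contractNth
    split_ifs
    · exact (contDiff_apply ℝ E _).contDiffOn
    · exact hm.comp ((contDiff_apply ℝ E k.castSucc).prodMk (contDiff_apply ℝ E k.succ)).contDiffOn
        fun y hy => ⟨hy _ trivial, hy _ trivial⟩
    · exact (contDiff_apply ℝ E _).contDiffOn
  · unfold Fin.contractNth
    dsimp only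
    split_ifs
    · exact hWU (hy _ trivial)
    · exact hmU _ (hy _ trivial) _ (hy _ trivial)
    · exact hWU (hy _ trivial)

/-- The mixed second derivative of `N (m (x, y))` at `(x₀, x₀)`. Its first term is symmetric in `a`
and `b`. -/
theorem mixed_comp_localMul {N : E → V} (hN : ContDiffAt ℝ 2 N x₀)
    (hm : ContDiffAt ℝ 2 m (x₀, x₀))
    (hl : ∀ᶠ x in nhds x₀, m (x, x₀) = x) (hr : ∀ᶠ y in nhds x₀, m (x₀, y) = y) (a b : E) :
    fderiv ℝ (fun x => fderiv ℝ (fun y => N (m (x, y))) x₀ b) x₀ a =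
      fderiv ℝ (fderiv ℝ N) x₀ a b +
        fderiv ℝ N x₀ (fderiv ℝ (fderiv ℝ m) (x₀, x₀) (a, 0) (0, b)) := by
  have h0 : m (x₀, x₀) = x₀ := hl.self_of_nhds
  have hN' : ContDiffAt ℝ 2 N (m (x₀, x₀)) := by rwa [h0]
  rw [fderiv_fderiv_partial_apply (f := fun p => N (m p)) (hN'.comp (x₀, x₀) hm),
    fderiv_fderiv_comp hN' hm, h0, fderiv_localMul hm hl hr, fderiv_localMul hm hl hr]
  simp

/-- Replacing two neighbouring variables by their product `m` changes the mixed derivative by a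
term symmetric in these two variables and by the mixed derivative in which they are contracted by
the mixed second derivative of `m`. -/
theorem mixedFDeriv_contractNth_sub_swap (hU : IsOpen U) (hW : IsOpen W) (hx₀ : x₀ ∈ W)
    (hm : ContDiffOn ℝ ∞ m (W ×ˢ W)) (hmU : ∀ x ∈ W, ∀ y ∈ W, m (x, y) ∈ U) (hWU : W ⊆ U)
    (hl : ∀ x ∈ W, m (x, x₀) = x) (hr : ∀ y ∈ W, m (x₀, y) = y) {n : ℕ} (j : Fin n)
    {f : (Fin n → E) → V} (hf : ContDiffOn ℝ ∞ f (Set.univ.pi fun _ => U)) (u : Fin (n + 1) → E) :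
    mixedFDeriv x₀ (n + 1) (fun y => f (Fin.contractNth j.castSucc (fun x y => m (x, y)) y)) u -
      mixedFDeriv x₀ (n + 1) (fun y => f (Fin.contractNth j.castSucc (fun x y => m (x, y)) y))
        (u ∘ Equiv.swap j.castSucc j.succ) =
      mixedFDeriv x₀ n f (Fin.contractNth j.castSucc (skewSnd m x₀) u) := by
  have hWn := hW.mem_nhds hx₀
  induction n with
  | zero => exact j.elim0
  | succ n ih =>
    have hg := contDiffOn_contractNth hm hmU hWU j.castSucc hf
    cases j using Fin.cases with
    | zero =>
      obtain ⟨a, u, rfl⟩ : ∃ a u', u = Fin.cons a u' := ⟨_, _, (Fin.cons_self_tail u).symm⟩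
      obtain ⟨b, u, rfl⟩ : ∃ a u', u = Fin.cons a u' := ⟨_, _, (Fin.cons_self_tail u).symm⟩
      have hsw : (Fin.cons a (Fin.cons b u : Fin (n + 1) → E) : Fin (n + 2) → E) ∘
          Equiv.swap (0 : Fin (n + 1)).castSucc (0 : Fin (n + 1)).succ =
            Fin.cons b (Fin.cons a u : Fin (n + 1) → E) := by
        funext k
        cases k using Fin.cases with
        | zero => simp
        | succ k =>
          cases k using Fin.cases with
          | zero => simp
          | succ k =>
            rw [Function.comp_apply, Equiv.swap_apply_of_ne_of_ne]
            · rfl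
            · simp [Fin.ext_iff]
            · simp [Fin.ext_iff]
      set N : E → V := fun x => mixedFDeriv x₀ n (fun z => f (Fin.cons x z)) u with hN
      have hNs : ContDiffOn ℝ ∞ N U :=
        (ContinuousMultilinearMap.apply ℝ (fun _ : Fin n => E) V u).contDiff.comp_contDiffOn
          (contDiffOn_mixedFDeriv_cons hU (hWU hx₀) hf)
      have hN2 : ContDiffAt ℝ 2 N x₀ :=
        (hNs.contDiffAt (hU.mem_nhds (hWU hx₀))).of_le ENat.LEInfty.out
      have hm2 : ContDiffAt ℝ 2 m (x₀, x₀) :=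
        (hm.contDiffAt ((hW.prod hW).mem_nhds ⟨hx₀, hx₀⟩)).of_le ENat.LEInfty.out
      have key : ∀ a b, mixedFDeriv x₀ (n + 2)
          (fun y => f (Fin.contractNth (0 : Fin (n + 1)).castSucc (fun x y => m (x, y)) y))
            (Fin.cons a (Fin.cons b u : Fin (n + 1) → E)) =
          fderiv ℝ (fderiv ℝ N) x₀ a b +
            fderiv ℝ N x₀ (fderiv ℝ (fderiv ℝ m) (x₀, x₀) (a, 0) (0, b)) := by
        intro a b
        have e : (fun x => mixedFDeriv x₀ (n + 1) (fun y => f (Fin.contractNth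
            (0 : Fin (n + 1)).castSucc (fun x y => m (x, y)) (Fin.cons x y : Fin (n + 2) → E)))
              (Fin.cons b u)) =ᶠ[nhds x₀] fun x => fderiv ℝ (fun y => N (m (x, y))) x₀ b := by
          filter_upwards [hWn] with x hx
          rw [mixedFDeriv_succ_apply' hW hx₀ (contDiffOn_cons_right hg hx)]
          simp only [contractNth_zero_cons, Fin.tail_cons, Fin.cons_zero, hN]
        rw [mixedFDeriv_succ_apply' hW hx₀ hg]
        simp only [Fin.tail_cons, Fin.cons_zero]
        rw [e.fderiv_eq]
        exact mixed_comp_localMul hN2 hm2 (Filter.eventually_of_mem hWn hl)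
          (Filter.eventually_of_mem hWn hr) a b
      rw [hsw, key, key, contractNth_zero_cons, mixedFDeriv_succ_apply' hU (hWU hx₀) hf,
        fderiv_fderiv_symm hN2 a b, skewSnd]
      simp only [Fin.cons_zero, Fin.tail_cons, map_sub]
      rw [← hN]
      abel
    | succ j =>
      obtain ⟨a, u, rfl⟩ : ∃ a u', u = Fin.cons a u' := ⟨_, _, (Fin.cons_self_tail u).symm⟩
      have hsw : (Fin.cons a u : Fin (n + 2) → E) ∘ Equiv.swap j.succ.castSucc j.succ.succ =
          Fin.cons a (u ∘ Equiv.swap j.castSucc j.succ) := by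
        funext k
        cases k using Fin.cases with
        | zero =>
          rw [Function.comp_apply, Equiv.swap_apply_of_ne_of_ne]
          · rfl
          · simp [Fin.ext_iff]
          · simp [Fin.ext_iff]
        | succ k =>
          rw [← Fin.succ_castSucc, Function.comp_apply,
            ← (Fin.succ_injective _).map_swap, Fin.cons_succ, Fin.cons_succ, Function.comp_apply]
      have hd : ∀ v : Fin (n + 1) → E, DifferentiableAt ℝ (fun x => mixedFDeriv x₀ (n + 1) (fun y =>
          f (Fin.contractNth j.succ.castSucc (fun x y => m (x, y)) (Fin.cons x y : Fin (n + 2) → E)))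
            v) x₀ := fun v =>
        (ContinuousMultilinearMap.apply ℝ (fun _ : Fin (n + 1) => E) V v).differentiableAt.comp _
          (differentiableAt_mixedFDeriv_cons hW hx₀ hg hx₀)
      rw [hsw, mixedFDeriv_succ_apply' hW hx₀ hg, mixedFDeriv_succ_apply' hW hx₀ hg,
        contractNth_succ_cons, mixedFDeriv_succ_apply' hU (hWU hx₀) hf]
      simp only [Fin.tail_cons, Fin.cons_zero]
      rw [← sub_apply, ← fderiv_fun_sub (hd _) (hd _)]
      have e : (fun x => mixedFDeriv x₀ (n + 1) (fun y =>
          f (Fin.contractNth j.succ.castSucc (fun x y => m (x, y)) (Fin.cons x y : Fin (n + 2) → E)))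
            u - mixedFDeriv x₀ (n + 1) (fun y =>
          f (Fin.contractNth j.succ.castSucc (fun x y => m (x, y)) (Fin.cons x y : Fin (n + 2) → E)))
            (u ∘ Equiv.swap j.castSucc j.succ)) =ᶠ[nhds x₀] fun x => mixedFDeriv x₀ n (fun y =>
              f (Fin.cons x y)) (Fin.contractNth j.castSucc (skewSnd m x₀) u) := by
        filter_upwards [hWn] with x hx
        simp only [contractNth_succ_cons]
        exact ih j (contDiffOn_cons_right hf (hWU hx)) u
      rw [e.fderiv_eq]

end Contraction

/-! ### Alternating sums over permutations -/

section AlternatingSums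

variable {V W : Type*} [AddCommGroup W] [Module ℝ W]

/-- The alternating sum `∑ₛ (-1)^|s| K (u ∘ s)` over all permutations of the arguments of `K`. -/
def altSum {n : ℕ} (K : (Fin n → V) → W) (u : Fin n → V) : W :=
  ∑ s : Equiv.Perm (Fin n), ((Equiv.Perm.sign s : ℤ) : ℝ) • K (u ∘ s)

theorem altSum_add {n : ℕ} (K K' : (Fin n → V) → W) (u : Fin n → V) :
    altSum (fun v => K v + K' v) u = altSum K u + altSum K' u := by
  simp [altSum, Finset.sum_add_distrib]

theorem altSum_smul {n : ℕ} (c : ℝ) (K : (Fin n → V) → W) (u : Fin n → V) :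
    altSum (fun v => c • K v) u = c • altSum K u := by
  simp only [altSum, Finset.smul_sum]
  exact Finset.sum_congr rfl fun s _ => smul_comm _ _ _

theorem altSum_sum {n : ℕ} {ι : Type*} (t : Finset ι) (K : ι → (Fin n → V) → W) (u : Fin n → V) :
    altSum (fun v => ∑ i ∈ t, K i v) u = ∑ i ∈ t, altSum (K i) u := by
  simp only [altSum, Finset.smul_sum]
  exact Finset.sum_comm

theorem map_altSum {W' : Type*} [AddCommGroup W'] [Module ℝ W'] (A : W →ₗ[ℝ] W') {n : ℕ}
    (K : (Fin n → V) → W) (u : Fin n → V) :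
    altSum (fun v => A (K v)) u = A (altSum K u) := by
  simp [altSum]

theorem altSum_comp_perm {n : ℕ} (K : (Fin n → V) → W) (p : Equiv.Perm (Fin n)) (u : Fin n → V) :
    altSum (fun v => K (v ∘ p)) u = ((Equiv.Perm.sign p : ℤ) : ℝ) • altSum K u := by
  simp only [altSum, Finset.smul_sum]
  refine Fintype.sum_equiv (Equiv.mulRight p) _ _ fun s => ?_
  have : ((Equiv.Perm.sign p : ℤ) : ℝ) * ((Equiv.Perm.sign p : ℤ) : ℝ) = 1 := by
    rcases Int.units_eq_one_or (Equiv.Perm.sign p) with h | h <;> simp [h]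
  simp only [Equiv.coe_mulRight, Equiv.Perm.sign_mul, Units.val_mul, Int.cast_mul,
    Equiv.Perm.coe_mul, smul_smul]
  rw [mul_comm, mul_assoc, this, mul_one]
  rfl

/-- Under an alternating sum, a function may be replaced by half its difference with the function in
which two arguments are exchanged. -/
theorem altSum_eq_half_sub_swap {n : ℕ} (K : (Fin n → V) → W) {i j : Fin n} (hij : i ≠ j)
    (u : Fin n → V) :
    altSum K u = (1 / 2 : ℝ) • altSum (fun v => K v - K (v ∘ Equiv.swap i j)) u := by
  have h := altSum_add K (fun v => (-1 : ℝ) • K (v ∘ Equiv.swap i j)) u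
  rw [altSum_smul, altSum_comp_perm, Equiv.Perm.sign_swap hij] at h
  simp only [neg_smul, one_smul, ← sub_eq_add_neg] at h
  rw [h]
  simp [← two_smul ℝ, smul_smul]

/-- A permutation of `n + 1` letters is determined by the image `i` of `0` and a permutation of the
remaining letters. -/
theorem bijective_cycleRange_symm_mul (n : ℕ) :
    Function.Bijective fun p : Fin (n + 1) × Equiv.Perm (Fin n) =>
      p.1.cycleRange.symm * Equiv.Perm.decomposeFin.symm (0, p.2) := by
  rw [Fintype.bijective_iff_injective_and_card]
  refine ⟨?_, (Fintype.card_congr Equiv.Perm.decomposeFin).symm⟩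
  rintro ⟨i, σ⟩ ⟨i', σ'⟩ h
  have h0 : i = i' := by simpa using congrArg (fun s : Equiv.Perm (Fin (n + 1)) => s 0) h
  subst h0
  have h1 := Equiv.Perm.decomposeFin.symm.injective (mul_left_cancel h)
  exact Prod.ext rfl (Prod.ext_iff.1 h1).2

theorem sign_cycleRange_symm_mul {n : ℕ} (i : Fin (n + 1)) (σ : Equiv.Perm (Fin n)) :
    ((Equiv.Perm.sign (i.cycleRange.symm * Equiv.Perm.decomposeFin.symm (0, σ)) : ℤ) : ℝ) =
      (-1) ^ (i : ℕ) * ((Equiv.Perm.sign σ : ℤ) : ℝ) := by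
  simp

/-- Expansion of an alternating sum by the vector in the first argument. -/
theorem altSum_succ {n : ℕ} (K : (Fin (n + 1) → V) → W) (u : Fin (n + 1) → V) :
    altSum K u = ∑ i : Fin (n + 1), (-1 : ℝ) ^ (i : ℕ) •
      altSum (fun v => K (Fin.cons (u i) v)) (i.removeNth u) := by
  simp only [altSum, Finset.smul_sum]
  rw [← Fintype.sum_prod_type']
  refine (Function.Bijective.sum_comp (bijective_cycleRange_symm_mul n) _).symm.trans
    (Finset.sum_congr rfl fun p _ => ?_)
  rw [sign_cycleRange_symm_mul, smul_smul]
  congr 2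
  funext k
  cases k using Fin.cases with
  | zero => simp
  | succ k => simp [Fin.removeNth]

/-- Expansion of an alternating sum by the position of the first vector. -/
theorem altSum_cons {n : ℕ} (K : (Fin (n + 1) → V) → W) (a : V) (u : Fin n → V) :
    altSum K (Fin.cons a u) = ∑ j : Fin (n + 1), (-1 : ℝ) ^ (j : ℕ) •
      altSum (fun v => K (j.insertNth a v)) u := by
  have h : ∀ σ : Equiv.Perm (Fin n), (Equiv.Perm.decomposeFin.symm ((0 : Fin (n + 1)), σ))⁻¹ =
      Equiv.Perm.decomposeFin.symm (0, σ⁻¹) := by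
    intro σ
    rw [inv_eq_iff_mul_eq_one]
    ext k
    cases k using Fin.cases <;> simp
  have h1 : altSum K (Fin.cons a u) = ∑ s : Equiv.Perm (Fin (n + 1)),
      ((Equiv.Perm.sign s⁻¹ : ℤ) : ℝ) • K ((Fin.cons a u : Fin (n + 1) → V) ∘ ⇑s⁻¹) :=
    (Equiv.sum_comp (Equiv.inv (Equiv.Perm (Fin (n + 1)))) fun s =>
      ((Equiv.Perm.sign s : ℤ) : ℝ) • K ((Fin.cons a u : Fin (n + 1) → V) ∘ ⇑s)).symm
  have h2 : ∀ j : Fin (n + 1), altSum (fun v => K (j.insertNth a v)) u =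
      ∑ σ : Equiv.Perm (Fin n), ((Equiv.Perm.sign σ⁻¹ : ℤ) : ℝ) • K (j.insertNth a (u ∘ ⇑σ⁻¹)) :=
    fun j => (Equiv.sum_comp (Equiv.inv (Equiv.Perm (Fin n))) fun σ =>
      ((Equiv.Perm.sign σ : ℤ) : ℝ) • K (j.insertNth a (u ∘ ⇑σ))).symm
  simp only [h1, h2, Finset.smul_sum]
  rw [← Fintype.sum_prod_type', ← Function.Bijective.sum_comp (bijective_cycleRange_symm_mul n)]
  refine Finset.sum_congr rfl fun p _ => ?_
  rw [Equiv.Perm.sign_inv, Equiv.Perm.sign_inv, sign_cycleRange_symm_mul, smul_smul]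
  congr 2
  rw [mul_inv_rev, h, ← Fin.cons_comp_cycleRange]
  funext k
  change (Fin.cons a u : Fin (n + 1) → V) (Equiv.Perm.decomposeFin.symm (0, p.2⁻¹)
    (p.1.cycleRange k)) = (Fin.cons a (u ∘ ⇑p.2⁻¹) : Fin (n + 1) → V) (p.1.cycleRange k)
  generalize p.1.cycleRange k = l
  cases l using Fin.cases <;> simp

/-- A double rotation moves the entries that are contracted to the front. -/
theorem contractNth_comp_cycleRange (br : V → V → V) {n : ℕ} (j : Fin (n + 1)) (v : Fin (n + 2) → V) :
    Fin.contractNth j.castSucc br (fun k => v (j.succ.cycleRange (j.succ.cycleRange k))) =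
      j.insertNth (br (v 0) (v 1)) (Fin.tail (Fin.tail v)) := by
  have h1 : j.succ.cycleRange j.castSucc = j.succ := by
    rw [Fin.cycleRange_of_lt (by simp [Fin.lt_def])]; simp
  have h2 : j.succ.cycleRange 0 = 1 := by
    rw [Fin.cycleRange_of_lt (by simp [Fin.lt_def])]; simp
  funext k
  rcases Fin.eq_self_or_eq_succAbove j k with rfl | ⟨l, rfl⟩
  · simp [Fin.contractNth, h1, h2]
  · rw [Fin.insertNth_apply_succAbove]
    rcases lt_or_ge l.castSucc j with h | h
    · have h3 : j.succ.cycleRange l.castSucc.castSucc = l.succ.castSucc := by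
        ext
        rw [Fin.coe_cycleRange_of_lt (by rw [Fin.lt_def] at h ⊢; simp at h ⊢; omega)]
        simp
      have h4 : j.succ.cycleRange l.succ.castSucc = l.succ.succ := by
        ext
        rw [Fin.coe_cycleRange_of_lt (by rw [Fin.lt_def] at h ⊢; simp at h ⊢; omega)]
        simp
      rw [Fin.succAbove_of_castSucc_lt _ _ h, Fin.contractNth,
        if_pos (by rw [Fin.lt_def] at h; simpa using h)]
      rw [← Fin.succ_castSucc] at h4
      simp [h3, h4, Fin.tail]
    · have h3 : j.succ.cycleRange l.succ.succ = l.succ.succ :=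
        Fin.cycleRange_of_gt (by rw [Fin.le_def] at h; rw [Fin.lt_def]; simp at h ⊢; omega)
      rw [Fin.succAbove_of_le_castSucc _ _ h, Fin.contractNth, if_neg, if_neg]
      · simp [h3, Fin.tail]
      · rw [Fin.le_def] at h; simp at h ⊢; omega
      · rw [Fin.le_def] at h; simp at h ⊢; omega

end AlternatingSums

section BracketSum

variable {V W : Type*} [AddCommGroup V] [Module ℝ V] [AddCommGroup W] [Module ℝ W]

/-- The bracket part of the Chevalley–Eilenberg differential, as a sum over all ordered pairs. -/
theorem ceBracketSum_succ (br : V →ₗ[ℝ] V →ₗ[ℝ] V) (hbr : ∀ u, br u u = 0) {n : ℕ}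
    (f : V [⋀^Fin (n + 1)]→ₗ[ℝ] W) (u : Fin (n + 2) → V) :
    ceBracketSum br (n + 1) f u = -(1 / 2 : ℝ) • ∑ i : Fin (n + 2), ∑ k : Fin (n + 1),
      ((-1 : ℝ) ^ (i : ℕ) * (-1) ^ (k : ℕ)) •
        f (Fin.cons (br (u i) (i.removeNth u k)) (k.removeNth (i.removeNth u))) := by
  have hsk : ∀ u v, br v u = - br u v := fun u v => by
    have := hbr (u + v)
    simp only [map_add, LinearMap.add_apply, hbr, zero_add, add_zero] at this
    exact eq_neg_of_add_eq_zero_left this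
  have h : ∑ i : Fin (n + 2), ∑ k : Fin (n + 1), ((-1 : ℝ) ^ (i : ℕ) * (-1) ^ (k : ℕ)) •
      f (Fin.cons (br (u i) (i.removeNth u k)) (k.removeNth (i.removeNth u))) =
      AlternatingMap.alternatizeUncurryFin
        (AlternatingMap.alternatizeUncurryFinLM ∘ₗ br.compr₂ f.curryLeft) u := by
    rw [AlternatingMap.alternatizeUncurryFin_apply]
    refine Finset.sum_congr rfl fun i _ => ?_
    rw [LinearMap.comp_apply, AlternatingMap.alternatizeUncurryFinLM_apply,
      AlternatingMap.alternatizeUncurryFin_apply, Finset.smul_sum]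
    refine Finset.sum_congr rfl fun k _ => ?_
    rw [mul_smul, ← Int.cast_smul_eq_zsmul ℝ, ← Int.cast_smul_eq_zsmul ℝ]
    simp [Matrix.vecCons]
  rw [h, AlternatingMap.alternatizeUncurryFin_alternatizeUncurryFinLM_comp_apply, ceBracketSum,
    Finset.smul_sum]
  refine Finset.sum_congr rfl fun i _ => ?_
  rw [Finset.smul_sum]
  refine Finset.sum_congr rfl fun j _ => ?_
  simp only [LinearMap.compr₂_apply, hsk (u i.castSucc), map_neg, AlternatingMap.neg_apply,
    AlternatingMap.curryLeft_apply_apply]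
  rw [Fin.val_castSucc, Fin.val_succ, sub_neg_eq_add, ← two_smul ℝ, ← add_assoc,
    pow_succ _ (_ + _), ← Int.cast_smul_eq_zsmul ℝ, smul_smul, smul_smul]
  congr 1
  push_cast
  ring

/-- Contracting neighbouring arguments of `M` by the bracket, alternating, and summing with signs over
the positions gives twice the bracket part of the Chevalley–Eilenberg differential of the
alternation of `M`. -/
theorem sum_altSum_contractNth (br : V →ₗ[ℝ] V →ₗ[ℝ] V) (hbr : ∀ u, br u u = 0) {n : ℕ}
    (M : (Fin n → V) → W) (f : V [⋀^Fin n]→ₗ[ℝ] W) (hf : ∀ v, f v = altSum M v)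
    (u : Fin (n + 1) → V) :
    ∑ j : Fin n, (-1 : ℝ) ^ ((j : ℕ) + 1) • (1 / 2 : ℝ) •
      altSum (fun v => M (Fin.contractNth j.castSucc (fun a b => br a b) v)) u =
      ceBracketSum br n f u := by
  cases n with
  | zero => simp [ceBracketSum]
  | succ n =>
    have h1 : ∀ j : Fin (n + 1),
        altSum (fun v => M (Fin.contractNth j.castSucc (fun a b => br a b) v)) u =
          ∑ i : Fin (n + 2), ∑ k : Fin (n + 1), ((-1 : ℝ) ^ (i : ℕ) * (-1) ^ (k : ℕ)) •
            altSum (fun z => M (j.insertNth (br (u i) (i.removeNth u k)) z))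
              (k.removeNth (i.removeNth u)) := by
      intro j
      -- an even permutation moves the two contracted arguments to the front
      have h2 := altSum_comp_perm (fun v => M (Fin.contractNth j.castSucc (fun a b => br a b) v))
        (j.succ.cycleRange * j.succ.cycleRange) u
      have h3 : ((Equiv.Perm.sign (j.succ.cycleRange * j.succ.cycleRange) : ℤ) : ℝ) = 1 := by
        rw [Equiv.Perm.sign_mul, Int.units_mul_self]; simp
      rw [h3, one_smul] at h2
      change altSum (fun v => M (Fin.contractNth j.castSucc (fun a b => br a b)
        fun k => v (j.succ.cycleRange (j.succ.cycleRange k)))) u = _ at h2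
      simp only [contractNth_comp_cycleRange] at h2
      rw [← h2, altSum_succ]
      refine Finset.sum_congr rfl fun i _ => ?_
      rw [altSum_succ, Finset.smul_sum]
      refine Finset.sum_congr rfl fun k _ => ?_
      rw [smul_smul]
      rfl
    simp only [h1, Finset.smul_sum]
    rw [ceBracketSum_succ br hbr, Finset.smul_sum, Finset.sum_comm]
    refine Finset.sum_congr rfl fun i _ => ?_
    rw [Finset.sum_comm, Finset.smul_sum]
    refine Finset.sum_congr rfl fun k _ => ?_
    rw [hf, altSum_cons, Finset.smul_sum, Finset.smul_sum]
    refine Finset.sum_congr rfl fun j _ => ?_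
    simp only [smul_smul]
    congr 1
    ring

end BracketSum

/-! ### Lie groups in a chart at the identity -/

section Chart

variable {E : Type*} [NormedAddCommGroup E] [NormedSpace ℝ E]
  {M : Type*} [TopologicalSpace M] [ChartedSpace E M]
  {E' : Type*} [NormedAddCommGroup E'] [NormedSpace ℝ E']
  {M' : Type*} [TopologicalSpace M'] [ChartedSpace E' M']

theorem mfderiv_eq_fderiv_chart {f : M → M'} {x : M} {y : M'}
    (hf : MDifferentiableAt 𝓘(ℝ, E) 𝓘(ℝ, E') f x) (hy : f x = y) :
    (mfderiv 𝓘(ℝ, E) 𝓘(ℝ, E') f x : E →L[ℝ] E') =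
      fderiv ℝ (fun z => extChartAt 𝓘(ℝ, E') y (f ((extChartAt 𝓘(ℝ, E) x).symm z)))
        (extChartAt 𝓘(ℝ, E) x x) := by
  subst hy
  rw [hf.mfderiv, ModelWithCorners.range_eq_univ, fderivWithin_univ]
  rfl

theorem contMDiffAt_chart_symm [IsManifold 𝓘(ℝ, E) ∞ M] (x : M) {z : E}
    (hz : z ∈ (extChartAt 𝓘(ℝ, E) x).target) :
    ContMDiffAt 𝓘(ℝ, E) 𝓘(ℝ, E) ∞ (extChartAt 𝓘(ℝ, E) x).symm z :=
  (contMDiffOn_extChartAt_symm x).contMDiffAt ((isOpen_extChartAt_target x).mem_nhds hz)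

/-- A smooth map, followed by a chart at its value. -/
theorem contDiffAt_chart_comp [IsManifold 𝓘(ℝ, E') ∞ M'] {P : Type*} [NormedAddCommGroup P]
    [NormedSpace ℝ P] {X : P → M'} {p : P} {y : M'} (hX : ContMDiffAt 𝓘(ℝ, P) 𝓘(ℝ, E') ∞ X p)
    (hy : X p ∈ (extChartAt 𝓘(ℝ, E') y).source) :
    ContDiffAt ℝ ∞ (fun q => extChartAt 𝓘(ℝ, E') y (X q)) p := by
  rw [extChartAt_source] at hy
  exact ((contMDiffAt_extChartAt' hy).comp p hX).contDiffAt

theorem eventually_chart_symm_chart {P : Type*} [TopologicalSpace P] {X : P → M} {p : P} {x : M}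
    (hX : ContinuousAt X p) (hx : X p = x) :
    ∀ᶠ q in nhds p, (extChartAt 𝓘(ℝ, E) x).symm (extChartAt 𝓘(ℝ, E) x (X q)) = X q := by
  subst hx
  filter_upwards [hX.preimage_mem_nhds (extChartAt_source_mem_nhds (I := 𝓘(ℝ, E)) (X p))] with q hq
  exact (extChartAt 𝓘(ℝ, E) (X p)).left_inv hq

theorem eventually_chart_chart_symm (x : M) :
    ∀ᶠ z in nhds (extChartAt 𝓘(ℝ, E) x x),
      extChartAt 𝓘(ℝ, E) x ((extChartAt 𝓘(ℝ, E) x).symm z) = z := by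
  filter_upwards [extChartAt_target_mem_nhds (I := 𝓘(ℝ, E)) x] with z hz
  exact (extChartAt 𝓘(ℝ, E) x).right_inv hz

end Chart

/-- The fields `x ↦ ∂₂ m (x, x₀) u` are the left invariant fields of a multiplication `m`. -/
theorem lieBracket_localMul {E : Type*} [NormedAddCommGroup E] [NormedSpace ℝ E] {m : E × E → E}
    {x₀ : E} (hm : ContDiffAt ℝ 2 m (x₀, x₀)) (hr : ∀ᶠ y in nhds x₀, m (x₀, y) = y) (u v : E) :
    VectorField.lieBracket ℝ (fun x => fderiv ℝ (fun y => m (x, y)) x₀ u)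
      (fun x => fderiv ℝ (fun y => m (x, y)) x₀ v) x₀ = skewSnd m x₀ u v := by
  have h : ∀ w : E, fderiv ℝ (fun y => m (x₀, y)) x₀ w = w := by
    intro w
    have : (fun y => m (x₀, y)) =ᶠ[nhds x₀] fun y => y := hr
    rw [this.fderiv_eq]
    simp
  rw [VectorField.lieBracket_eq, skewSnd]
  dsimp only
  rw [h, h, fderiv_fderiv_partial_apply hm, fderiv_fderiv_partial_apply hm]

section LieGroupChart

variable {E : Type*} [NormedAddCommGroup E] [NormedSpace ℝ E]
  {L : Type*} [TopologicalSpace L] [ChartedSpace E L] [Group L]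

variable (E L) in
/-- The preferred chart at the identity. -/
abbrev oneChart : PartialEquiv L E := extChartAt 𝓘(ℝ, E) (1 : L)

variable (E L) in
/-- The coordinates of the identity in the preferred chart. -/
abbrev oneCoord : E := oneChart E L 1

variable (E L) in
/-- The multiplication in the preferred chart at the identity. -/
def chartMul (p : E × E) : E :=
  oneChart E L ((oneChart E L).symm p.1 * (oneChart E L).symm p.2)

theorem oneCoord_mem : oneCoord E L ∈ (oneChart E L).target := mem_extChartAt_target 1

theorem oneChart_symm_oneCoord : (oneChart E L).symm (oneCoord E L) = 1 := extChartAt_to_inv 1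

theorem chartMul_oneCoord {x : E} (hx : x ∈ (oneChart E L).target) :
    chartMul E L (x, oneCoord E L) = x := by
  rw [chartMul, oneChart_symm_oneCoord, mul_one]
  exact (oneChart E L).right_inv hx

theorem oneCoord_chartMul {x : E} (hx : x ∈ (oneChart E L).target) :
    chartMul E L (oneCoord E L, x) = x := by
  rw [chartMul, oneChart_symm_oneCoord, one_mul]
  exact (oneChart E L).right_inv hx

theorem mulInvariantVectorField_one' (u : GroupLieAlgebra 𝓘(ℝ, E) L) :
    (mulInvariantVectorField u (1 : L) : E) = u := by
  have : (fun x : L => 1 * x) = id := by ext; simp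
  rw [mulInvariantVectorField, this, mfderiv_id]
  rfl

variable [LieGroup 𝓘(ℝ, E) ∞ L]

theorem contMDiffAt_oneChart_symm {z : E} (hz : z ∈ (oneChart E L).target) :
    ContMDiffAt 𝓘(ℝ, E) 𝓘(ℝ, E) ∞ (oneChart E L).symm z :=
  contMDiffAt_chart_symm 1 hz

theorem contMDiffAt_oneChart_symm_mul {p : E × E} (h1 : p.1 ∈ (oneChart E L).target)
    (h2 : p.2 ∈ (oneChart E L).target) :
    ContMDiffAt 𝓘(ℝ, E × E) 𝓘(ℝ, E) ∞
      (fun p : E × E => (oneChart E L).symm p.1 * (oneChart E L).symm p.2) p :=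
  (ContMDiffAt.comp p (contMDiffAt_oneChart_symm h1) contDiffAt_fst.contMDiffAt).mul
    (ContMDiffAt.comp p (contMDiffAt_oneChart_symm h2) contDiffAt_snd.contMDiffAt)

variable (E L) in
/-- A neighbourhood of the identity in the chart on which the multiplication stays in the chart. -/
theorem exists_open_chartMul : ∃ W : Set E, IsOpen W ∧ oneCoord E L ∈ W ∧
    W ⊆ (oneChart E L).target ∧ ContDiffOn ℝ ∞ (chartMul E L) (W ×ˢ W) ∧
    ∀ x ∈ W, ∀ y ∈ W, (oneChart E L).symm x * (oneChart E L).symm y ∈ (oneChart E L).source := by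
  have hc := (contMDiffAt_oneChart_symm_mul (p := (oneCoord E L, oneCoord E L))
    oneCoord_mem oneCoord_mem).continuousAt
  have hs : (oneChart E L).source ∈ nhds ((oneChart E L).symm (oneCoord E L) *
      (oneChart E L).symm (oneCoord E L)) := by
    rw [oneChart_symm_oneCoord, mul_one]
    exact extChartAt_source_mem_nhds 1
  have h1 := hc.preimage_mem_nhds hs
  rw [nhds_prod_eq, Filter.mem_prod_same_iff] at h1
  obtain ⟨t, ht, hts⟩ := h1
  obtain ⟨W, hWt, hW, hxW⟩ := mem_nhds_iff.1
    (Filter.inter_mem ht ((isOpen_extChartAt_target (I := 𝓘(ℝ, E)) (1 : L)).mem_nhds oneCoord_mem))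
  refine ⟨W, hW, hxW, fun x hx => (hWt hx).2, ?_, fun x hx y hy =>
    hts (Set.mk_mem_prod (hWt hx).1 (hWt hy).1)⟩
  rintro ⟨x, y⟩ ⟨hx, hy⟩
  exact (contDiffAt_chart_comp (contMDiffAt_oneChart_symm_mul (hWt hx).2 (hWt hy).2)
    (hts (Set.mk_mem_prod (hWt hx).1 (hWt hy).1))).contDiffWithinAt

theorem contDiffAt_chartMul : ContDiffAt ℝ ∞ (chartMul E L) (oneCoord E L, oneCoord E L) := by
  obtain ⟨W, hW, hx, -, h, -⟩ := exists_open_chartMul E L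
  exact h.contDiffAt ((hW.prod hW).mem_nhds ⟨hx, hx⟩)

/-- An invariant vector field in the chart at the identity. -/
theorem mpullbackWithin_mulInvariantVectorField (u : GroupLieAlgebra 𝓘(ℝ, E) L) :
    ∀ᶠ x in nhds (oneCoord E L),
      (VectorField.mpullbackWithin 𝓘(ℝ, E) 𝓘(ℝ, E) (oneChart E L).symm
        (mulInvariantVectorField u) (Set.range 𝓘(ℝ, E)) x : E) =
      fderiv ℝ (fun y => chartMul E L (x, y)) (oneCoord E L) u := by
  filter_upwards [extChartAt_target_mem_nhds (I := 𝓘(ℝ, E)) (1 : L)] with x hx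
  have h1 : IsManifold 𝓘(ℝ, E) 1 L := IsManifold.of_le (n := ∞) ENat.LEInfty.out
  have hinv : (mfderivWithin 𝓘(ℝ, E) 𝓘(ℝ, E) (oneChart E L).symm (Set.range 𝓘(ℝ, E)) x).inverse =
      mfderiv 𝓘(ℝ, E) 𝓘(ℝ, E) (oneChart E L) ((oneChart E L).symm x) :=
    ContinuousLinearMap.inverse_eq (mfderivWithin_extChartAt_symm_comp_mfderiv_extChartAt hx)
      (mfderiv_extChartAt_comp_mfderivWithin_extChartAt_symm hx)
  have hs : (oneChart E L).symm x ∈ (chartAt E (1 : L)).source := by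
    rw [← extChartAt_source 𝓘(ℝ, E)]
    exact (oneChart E L).map_target hx
  have hd1 : MDifferentiableAt 𝓘(ℝ, E) 𝓘(ℝ, E) (oneChart E L) ((oneChart E L).symm x) :=
    mdifferentiableAt_extChartAt hs
  have hd2 : MDifferentiableAt 𝓘(ℝ, E) 𝓘(ℝ, E) (fun g => (oneChart E L).symm x * g) 1 :=
    (contMDiff_mul_left (I := 𝓘(ℝ, E)) (n := ∞)).mdifferentiableAt (by simp)
  have hc := mfderiv_comp_of_eq (x := (1 : L)) hd1 hd2 (mul_one _)
  have hd1' : MDifferentiableAt 𝓘(ℝ, E) 𝓘(ℝ, E) (oneChart E L) ((oneChart E L).symm x * 1) := by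
    rwa [mul_one]
  have hd : MDifferentiableAt 𝓘(ℝ, E) 𝓘(ℝ, E)
      (oneChart E L ∘ fun g => (oneChart E L).symm x * g) 1 :=
    MDifferentiableAt.comp (1 : L) hd1' hd2
  have hf := mfderiv_eq_fderiv_chart hd rfl
  rw [VectorField.mpullbackWithin_apply, hinv]
  have key : ∀ y : L, (oneChart E L).symm x * 1 = y →
      (mfderiv 𝓘(ℝ, E) 𝓘(ℝ, E) (oneChart E L) y : E →L[ℝ] E)
        (mulInvariantVectorField u ((oneChart E L).symm x)) =
      (mfderiv 𝓘(ℝ, E) 𝓘(ℝ, E) (oneChart E L ∘ fun g => (oneChart E L).symm x * g) 1 :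
        E →L[ℝ] E) u := by
    rintro _ rfl
    exact (congrArg (fun A : E →L[ℝ] E => A u) hc).symm
  refine (key _ (mul_one _)).trans ?_
  rw [hf]
  rfl

/-- The Lie bracket of a Lie group, in the chart at the identity. -/
theorem lie_eq_skewSnd_chartMul (u v : GroupLieAlgebra 𝓘(ℝ, E) L) :
    (⁅u, v⁆ : GroupLieAlgebra 𝓘(ℝ, E) L) = skewSnd (chartMul E L) (oneCoord E L) u v := by
  have h1 : IsManifold 𝓘(ℝ, E) 1 L := IsManifold.of_le (n := ∞) ENat.LEInfty.out
  have h2 := (mpullbackWithin_mulInvariantVectorField u)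
  have h3 := (mpullbackWithin_mulInvariantVectorField v)
  rw [GroupLieAlgebra.bracket_def, ← VectorField.mlieBracketWithin_univ,
    VectorField.mlieBracketWithin_apply]
  have h0 : ∀ w : E, (mfderiv 𝓘(ℝ, E) 𝓘(ℝ, E) (oneChart E L) 1 : E →L[ℝ] E).inverse w = w := by
    intro w
    have : (mfderiv 𝓘(ℝ, E) 𝓘(ℝ, E) (oneChart E L) 1 : E →L[ℝ] E) = ContinuousLinearMap.id ℝ E :=
      mfderiv_extChartAt_self
    exact (congrArg (fun A : E →L[ℝ] E => A.inverse w) this).trans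
      (congrArg (fun A : E →L[ℝ] E => A w) ContinuousLinearMap.inverse_id)
  refine (h0 _).trans ?_
  rw [ModelWithCorners.range_eq_univ] at h2 h3 ⊢
  rw [Set.preimage_univ, Set.univ_inter]
  refine (congrFun (VectorField.lieBracketWithin_univ (𝕜 := ℝ) (E := E) (V := _) (W := _)) _).trans
    ?_
  have h4 := Filter.EventuallyEq.lieBracket_vectorField_eq (𝕜 := ℝ) h2 h3
  refine h4.trans ?_
  exact lieBracket_localMul (E := E) (m := chartMul E L) (x₀ := oneCoord E L)
    (contDiffAt_chartMul.of_le ENat.LEInfty.out)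
    (Filter.eventually_of_mem (extChartAt_target_mem_nhds 1) fun y => oneCoord_chartMul) u v

variable [FiniteDimensional ℝ E] [T2Space L]

theorem exists_hasDerivAt_lieExp (u : GroupLieAlgebra 𝓘(ℝ, E) L) :
    (oneChart E L (lieExp ((0 : ℝ) • u)) = oneCoord E L) ∧
    HasDerivAt (fun t : ℝ => oneChart E L (lieExp (t • u))) u 0 ∧
    ∀ᶠ t : ℝ in nhds 0, lieExp (t • u) ∈ (oneChart E L).source := by
  obtain ⟨h0, hγ⟩ := Classical.choose_spec (exists_oneParameterCurve u)
  set γ := Classical.choose (exists_oneParameterCurve u)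
  -- `s ↦ γ (s t)` is the integral curve of the invariant vector field of `t • u`
  have key : ∀ t : ℝ, lieExp (t • u) = γ t := by
    intro t
    obtain ⟨k0, hk⟩ := Classical.choose_spec (exists_oneParameterCurve (t • u))
    have h1 := hγ.comp_mul t
    rw [← mulInvariantVectorField_smul] at h1
    have hv' : ContMDiff 𝓘(ℝ, E) 𝓘(ℝ, E).tangent 1
        (fun g : L => (⟨g, mulInvariantVectorField (t • u) g⟩ : TangentBundle 𝓘(ℝ, E) L)) :=
      (contMDiff_mulInvariantVectorField (t • u)).of_le (by
        simp only [minSmoothness_of_isRCLikeNormedField]; norm_num)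
    have h2 := isMIntegralCurve_Ioo_eq_of_contMDiff_boundaryless (t₀ := 0) hv' hk h1
      (by rw [k0, Function.comp_apply, zero_mul, h0])
    rw [lieExp, h2]
    simp
  simp only [key]
  refine ⟨by rw [h0], ?_, ?_⟩
  -- the base point `γ 0` occurs in the types, so the vector is generalized before it is rewritten
  · have h3 : ∀ e : E, e = mulInvariantVectorField u (γ 0) →
        HasFDerivWithinAt (fun t => extChartAt 𝓘(ℝ, E) (γ 0) (γ t))
          ((1 : ℝ →L[ℝ] ℝ).smulRight e) (Set.range 𝓘(ℝ, ℝ)) 0 := by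
      rintro e rfl
      exact (hγ 0).2
    have h4 : ∀ g : L, g = 1 → (u : E) = mulInvariantVectorField u g := by
      rintro _ rfl
      exact (mulInvariantVectorField_one' u).symm
    have h5 : ∀ e : E, e = mulInvariantVectorField u (γ 0) →
        HasDerivAt (fun t => extChartAt 𝓘(ℝ, E) (γ 0) (γ t)) e 0 := by
      intro e he
      have h := h3 e he
      rw [ModelWithCorners.range_eq_univ, hasFDerivWithinAt_univ] at h
      simpa using h.hasDerivAt
    have h6 := h5 u (h4 _ h0)
    rw [h0] at h6
    exact h6
  · have := hγ.continuous.continuousAt.preimage_mem_nhds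
      (by rw [h0]; exact extChartAt_source_mem_nhds (I := 𝓘(ℝ, E)) (1 : L))
    exact this

end LieGroupChart

/-! ### The van Est map of a representation -/

section VanEst

theorem mixedDeriv_congr {V : Type*} [NormedAddCommGroup V] [NormedSpace ℝ V] {n : ℕ}
    {g g' : (Fin n → ℝ) → V} {S : Fin n → Set ℝ} (hS : ∀ i, S i ∈ nhds 0)
    (h : ∀ t, (∀ i, t i ∈ S i) → g t = g' t) : mixedDeriv n g = mixedDeriv n g' := by
  induction n with
  | zero => exact h _ fun i => i.elim0
  | succ n ih =>
    refine Filter.EventuallyEq.deriv_eq ?_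
    filter_upwards [hS 0] with t ht
    refine ih (S := fun i => S i.succ) (fun i => hS i.succ) fun τ hτ => h _ fun i => ?_
    cases i using Fin.cases with
    | zero => exact ht
    | succ i => exact hτ i

universe u v
variable {E : Type u} [NormedAddCommGroup E] [NormedSpace ℝ E]
  {L : Type*} [TopologicalSpace L] [ChartedSpace E L] [Group L]
  {V : Type v} [NormedAddCommGroup V] [NormedSpace ℝ V]

/-- A function on `Lⁿ` in the coordinates of the chart at the identity. -/
def chartCochain (E : Type*) [NormedAddCommGroup E] [NormedSpace ℝ E] {L : Type*}
    [TopologicalSpace L] [ChartedSpace E L] [Group L] {V : Type*} {n : ℕ} (F : (Fin n → L) → V)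
    (x : Fin n → E) : V :=
  F fun i => (oneChart E L).symm (x i)

variable [LieGroup 𝓘(ℝ, E) ∞ L]

theorem contDiffOn_chartCochain {n : ℕ} (F : SmoothCochain E L V n) :
    ContDiffOn ℝ ∞ (chartCochain E F.1) (Set.univ.pi fun _ => (oneChart E L).target) := by
  intro x hx
  have hF : ContMDiff (ModelWithCorners.pi fun _ : Fin n => 𝓘(ℝ, E)) 𝓘(ℝ, V) ∞ F.1 := F.2
  refine ContDiffAt.contDiffWithinAt (contMDiffAt_iff_contDiffAt.1 ?_)
  refine ContMDiffAt.comp x hF.contMDiffAt (contMDiffAt_pi_iff.2 fun i => ?_)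
  exact ContMDiffAt.comp x (contMDiffAt_oneChart_symm (hx i trivial))
    (contDiff_apply ℝ E i).contMDiff.contMDiffAt

theorem contDiffOn_rep (ρ : SmoothRep E L V) :
    ContDiffOn ℝ ∞ (fun x => ρ.toHom ((oneChart E L).symm x)) (oneChart E L).target := fun _ hx =>
  (contMDiffAt_iff_contDiffAt.1 (ρ.smooth.contMDiffAt.comp _
    (contMDiffAt_oneChart_symm hx))).contDiffWithinAt

theorem vanEst_eq_altSum [FiniteDimensional ℝ E] [T2Space L] {n : ℕ} (F : SmoothCochain E L V n)
    (u : Fin n → GroupLieAlgebra 𝓘(ℝ, E) L) :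
    vanEst F.1 u =
      altSum (fun v : Fin n → E => mixedFDeriv (oneCoord E L) n (chartCochain E F.1) v) u := by
  refine Finset.sum_congr rfl fun s _ => congrArg _ ?_
  choose h0 hd hs using fun v : GroupLieAlgebra 𝓘(ℝ, E) L => exists_hasDerivAt_lieExp (L := L) v
  have h0' : ∀ i, oneChart E L (lieExp ((0 : ℝ) • u (s i))) = oneCoord E L := fun i => h0 _
  refine Eq.trans ?_ (mixedDeriv_comp_curves (isOpen_extChartAt_target 1) oneCoord_mem
    (contDiffOn_chartCochain F) (c := fun i t => oneChart E L (lieExp (t • u (s i)))) h0'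
    fun i => hd (u (s i)))
  refine mixedDeriv_congr (fun i => hs (u (s i))) fun t ht => ?_
  exact congrArg F.1 (funext fun i => ((oneChart E L).left_inv (ht i)).symm)

theorem contDiffOn_clm_apply_tail {U : Set E} {R : E → V →L[ℝ] V} (hR : ContDiffOn ℝ ∞ R U) {n : ℕ}
    {f : (Fin n → E) → V} (hf : ContDiffOn ℝ ∞ f (Set.univ.pi fun _ => U)) :
    ContDiffOn ℝ ∞ (fun x : Fin (n + 1) → E => R (x 0) (f (Fin.tail x)))
      (Set.univ.pi fun _ => U) := by
  have ht : ContDiff ℝ ∞ (fun x : Fin (n + 1) → E => (Fin.tail x : Fin n → E)) :=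
    contDiff_pi.2 fun i : Fin n => contDiff_apply ℝ E (Fin.succ i)
  refine ContDiffOn.clm_apply ?_ ?_
  · exact hR.comp (contDiff_apply ℝ E (0 : Fin (n + 1))).contDiffOn fun x hx => hx 0 trivial
  · exact hf.comp ht.contDiffOn fun x hx i _ => hx i.succ trivial

theorem mixedFDeriv_clm_apply {x₀ : E} {U : Set E} (hU : IsOpen U) (hx₀ : x₀ ∈ U)
    {R : E → V →L[ℝ] V} (hR : ContDiffOn ℝ ∞ R U) {n : ℕ} {f : (Fin n → E) → V}
    (hf : ContDiffOn ℝ ∞ f (Set.univ.pi fun _ => U)) (u : Fin (n + 1) → E) :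
    mixedFDeriv x₀ (n + 1) (fun x => R (x 0) (f (Fin.tail x))) u =
      fderiv ℝ R x₀ (u 0) (mixedFDeriv x₀ n f (Fin.tail u)) := by
  have hg : ContDiffOn ℝ ∞ (fun x : Fin (n + 1) → E => R (x 0) (f (Fin.tail x)))
      (Set.univ.pi fun _ => U) := contDiffOn_clm_apply_tail hR hf
  rw [mixedFDeriv_succ_apply' hU hx₀ hg]
  have h1 : (fun x => mixedFDeriv x₀ n (fun y => R ((Fin.cons x y : Fin (n + 1) → E) 0)
      (f (Fin.tail (Fin.cons x y : Fin (n + 1) → E)))) (Fin.tail u)) =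
      fun x => R x (mixedFDeriv x₀ n f (Fin.tail u)) := by
    funext x
    simp only [Fin.cons_zero, Fin.tail_cons]
    rw [mixedFDeriv_clm_comp hU hx₀ (R x) hf]
    rfl
  have hd : DifferentiableAt ℝ R x₀ :=
    (hR.contDiffAt (hU.mem_nhds hx₀)).differentiableAt (by simp)
  rw [h1, (hd.hasFDerivAt.clm_apply (hasFDerivAt_const _ x₀)).fderiv]
  simp

/-- The alternated mixed derivative of the differential of a group cochain is the Chevalley–Eilenberg
differential of the alternated mixed derivative, if the bracket and the representation are the
derivatives at the identity of the multiplication and of the group representation. -/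
theorem altSum_mixedFDeriv_d (ρ : SmoothRep E L V) {n : ℕ} (F : SmoothCochain E L V n)
    (br : E →ₗ[ℝ] E →ₗ[ℝ] E) (hbr : ∀ a b, br a b = skewSnd (chartMul E L) (oneCoord E L) a b)
    (θ : E →ₗ[ℝ] V →ₗ[ℝ] V)
    (hθ : ∀ a, ⇑(θ a) = fderiv ℝ (fun x => ρ.toHom ((oneChart E L).symm x)) (oneCoord E L) a)
    (f : E [⋀^Fin n]→ₗ[ℝ] V)
    (hf : ∀ v, f v = altSum (fun v => mixedFDeriv (oneCoord E L) n (chartCochain E F.1) v) v)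
    (u : Fin (n + 1) → E) :
    altSum (fun v => mixedFDeriv (oneCoord E L) (n + 1) (chartCochain E (ρ.d n F).1) v) u =
      ceSum br θ n f u := by
  obtain ⟨W, hW, hxW, hWt, hm, hms⟩ := exists_open_chartMul E L
  have hUo : IsOpen (oneChart E L).target := isOpen_extChartAt_target 1
  have hfs := contDiffOn_chartCochain F
  have hmU : ∀ x ∈ W, ∀ y ∈ W, chartMul E L (x, y) ∈ (oneChart E L).target :=
    fun x hx y hy => (oneChart E L).map_source (hms x hx y hy)
  set x₀ := oneCoord E L
  set fc := chartCochain E F.1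
  set R : E → V →L[ℝ] V := fun x => ρ.toHom ((oneChart E L).symm x)
  have hRs : ContDiffOn ℝ ∞ R W := (contDiffOn_rep ρ).mono hWt
  have hpi : (Set.univ.pi fun _ : Fin n => W) ⊆ Set.univ.pi fun _ => (oneChart E L).target :=
    Set.pi_mono fun _ _ => hWt
  set G : Fin n → (Fin (n + 1) → E) → V := fun j x =>
    fc (Fin.contractNth j.castSucc (fun a b => chartMul E L (a, b)) x)
  have hGs : ∀ j, ContDiffOn ℝ ∞ (G j) (Set.univ.pi fun _ => W) := fun j =>
    contDiffOn_contractNth hm hmU hWt j.castSucc hfs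
  have hinit : ContDiffOn ℝ ∞ (fun x : Fin (n + 1) → E => fc fun i => x i.castSucc)
      (Set.univ.pi fun _ => W) := by
    have hi : ContDiff ℝ ∞ (fun (x : Fin (n + 1) → E) (i : Fin n) => x i.castSucc) :=
      contDiff_pi.2 fun i => contDiff_apply ℝ E i.castSucc
    exact hfs.comp hi.contDiffOn fun x hx i _ => hWt (hx _ trivial)
  have htail : ContDiffOn ℝ ∞ (fun x : Fin (n + 1) → E => R (x 0) (fc (Fin.tail x)))
      (Set.univ.pi fun _ => W) := contDiffOn_clm_apply_tail hRs (hfs.mono hpi)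
  have hsum : ContDiffOn ℝ ∞ (fun x => ∑ j : Fin n, (-1 : ℝ) ^ ((j : ℕ) + 1) • G j x)
      (Set.univ.pi fun _ => W) :=
    ContDiffOn.sum fun j _ => (hGs j).const_smul _
  -- the differential in the chart
  have h1 : Set.EqOn (chartCochain E (ρ.d n F).1)
      (fun x => R (x 0) (fc (Fin.tail x)) + ∑ j : Fin n, (-1 : ℝ) ^ ((j : ℕ) + 1) • G j x +
        (-1 : ℝ) ^ (n + 1) • fc fun i => x i.castSucc) (Set.univ.pi fun _ => W) := by
    intro x hx
    refine congrArg₂ _ (congrArg₂ _ rfl (Finset.sum_congr rfl fun j _ => congrArg _ ?_)) rfl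
    refine congrArg F.1 (funext fun i => ?_)
    simp only [Fin.contractNth]
    split_ifs
    · rfl
    · exact ((oneChart E L).left_inv (hms _ (hx _ trivial) _ (hx _ trivial))).symm
    · rfl
  -- the last term of the differential does not contribute, by `mixedFDeriv_init`
  have h2 : ∀ v, mixedFDeriv x₀ (n + 1) (chartCochain E (ρ.d n F).1) v =
      θ (v 0) (mixedFDeriv x₀ n fc (Fin.tail v)) +
        ∑ j : Fin n, (-1 : ℝ) ^ ((j : ℕ) + 1) • mixedFDeriv x₀ (n + 1) (G j) v := by
    intro v
    rw [mixedFDeriv_congr hW hxW h1, mixedFDeriv_add hW hxW (htail.add hsum) (hinit.const_smul _),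
      mixedFDeriv_add hW hxW htail hsum, mixedFDeriv_smul hW hxW _ hinit, mixedFDeriv_init,
      smul_zero, add_zero, mixedFDeriv_sum hW hxW _ fun j => (hGs j).const_smul _, hθ]
    simp only [mixedFDeriv_smul hW hxW _ (hGs _)]
    simp only [add_apply, sum_apply, smul_apply]
    rw [mixedFDeriv_clm_apply hW hxW hRs (hfs.mono hpi)]
  -- after alternation only the skew-symmetric part in the contracted variables remains
  have h3 : ∀ j : Fin n, altSum (fun v => mixedFDeriv x₀ (n + 1) (G j) v) u = (1 / 2 : ℝ) •
      altSum (fun v => mixedFDeriv x₀ n fc (Fin.contractNth j.castSucc (fun a b => br a b) v)) u := by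
    intro j
    rw [altSum_eq_half_sub_swap _ (i := j.castSucc) (j := j.succ) (by simp [Fin.ext_iff])]
    congr 2
    funext v
    have hb : (fun a b => br a b) = skewSnd (chartMul E L) x₀ :=
      funext fun a => funext fun b => hbr a b
    rw [hb]
    exact mixedFDeriv_contractNth_sub_swap hUo hW hxW hm hmU hWt
      (fun x hx => chartMul_oneCoord (hWt hx)) (fun x hx => oneCoord_chartMul (hWt hx)) j hfs v
  simp only [h2]
  rw [altSum_add, altSum_sum, ceSum]
  simp only [altSum_smul, h3]
  rw [sum_altSum_contractNth br (fun a => by rw [hbr, skewSnd, sub_self]) _ f hf, altSum_succ]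
  congr 1
  refine Finset.sum_congr rfl fun i _ => ?_
  simp only [Fin.cons_zero, Fin.tail_cons]
  rw [map_altSum, hf]

end VanEst

/-! ### Products in the chart at the identity -/

section ProductRule

variable {E : Type*} [NormedAddCommGroup E] [NormedSpace ℝ E]
  {L : Type*} [TopologicalSpace L] [ChartedSpace E L] [Group L]

variable (E L) in
/-- The mixed second derivative at the identity of the multiplication in the chart. -/
def sndMul (a b : E) : E :=
  fderiv ℝ (fderiv ℝ (chartMul E L)) (oneCoord E L, oneCoord E L) (a, 0) (0, b)

@[simp] theorem sndMul_zero_left (b : E) : sndMul E L 0 b = 0 := by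
  rw [sndMul, Prod.mk_zero_zero, map_zero, zero_apply]

theorem sndMul_neg_left (a b : E) : sndMul E L (-a) b = -sndMul E L a b := by
  have : ((-a, 0) : E × E) = -(a, 0) := by simp
  rw [sndMul, this, map_neg, neg_apply, sndMul]

theorem sndMul_neg_right (a b : E) : sndMul E L a (-b) = -sndMul E L a b := by
  have : ((0, -b) : E × E) = -(0, b) := by simp
  rw [sndMul, this, map_neg, sndMul]

variable {P : Type*} [NormedAddCommGroup P] [NormedSpace ℝ P] {X Y : P → L} {p : P}

theorem eventually_oneChart_mul (hX : ContMDiffAt 𝓘(ℝ, P) 𝓘(ℝ, E) ∞ X p) (hX1 : X p = 1)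
    (hY : ContMDiffAt 𝓘(ℝ, P) 𝓘(ℝ, E) ∞ Y p) (hY1 : Y p = 1) :
    (fun q => oneChart E L (X q * Y q)) =ᶠ[nhds p]
      fun q => chartMul E L (oneChart E L (X q), oneChart E L (Y q)) := by
  filter_upwards [eventually_chart_symm_chart (E := E) hX.continuousAt hX1,
    eventually_chart_symm_chart (E := E) hY.continuousAt hY1] with q h1 h2
  rw [chartMul, h1, h2]

variable [LieGroup 𝓘(ℝ, E) ∞ L]

theorem contDiffAt_oneChart_comp (hX : ContMDiffAt 𝓘(ℝ, P) 𝓘(ℝ, E) ∞ X p) (hX1 : X p = 1) :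
    ContDiffAt ℝ ∞ (fun q => oneChart E L (X q)) p :=
  contDiffAt_chart_comp hX (by rw [hX1]; exact mem_extChartAt_source 1)

theorem fderiv_oneChart_mul (hX : ContMDiffAt 𝓘(ℝ, P) 𝓘(ℝ, E) ∞ X p) (hX1 : X p = 1)
    (hY : ContMDiffAt 𝓘(ℝ, P) 𝓘(ℝ, E) ∞ Y p) (hY1 : Y p = 1) (v : P) :
    fderiv ℝ (fun q => oneChart E L (X q * Y q)) p v =
      fderiv ℝ (fun q => oneChart E L (X q)) p v + fderiv ℝ (fun q => oneChart E L (Y q)) p v := by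
  have hXd := ((contDiffAt_oneChart_comp hX hX1).differentiableAt (by simp)).hasFDerivAt
  have hYd := ((contDiffAt_oneChart_comp hY hY1).differentiableAt (by simp)).hasFDerivAt
  have hm2 : ContDiffAt ℝ 2 (chartMul E L) (oneCoord E L, oneCoord E L) :=
    contDiffAt_chartMul.of_le ENat.LEInfty.out
  have hm : HasFDerivAt (chartMul E L) (fderiv ℝ (chartMul E L) (oneCoord E L, oneCoord E L))
      (oneChart E L (X p), oneChart E L (Y p)) := by
    rw [hX1, hY1]
    exact (hm2.differentiableAt (by simp)).hasFDerivAt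
  have h := HasFDerivAt.comp (g := chartMul E L)
    (f := fun q => (oneChart E L (X q), oneChart E L (Y q))) p hm (hXd.prodMk hYd)
  rw [(eventually_oneChart_mul hX hX1 hY hY1).fderiv_eq]
  refine (congrArg (fun A : P →L[ℝ] E => A v) h.fderiv).trans ?_
  exact fderiv_localMul hm2
    (Filter.eventually_of_mem (extChartAt_target_mem_nhds 1) fun y => chartMul_oneCoord)
    (Filter.eventually_of_mem (extChartAt_target_mem_nhds 1) fun y => oneCoord_chartMul) _

theorem fderiv_fderiv_clm {E₁ E₂ : Type*} [NormedAddCommGroup E₁] [NormedSpace ℝ E₁]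
    [NormedAddCommGroup E₂] [NormedSpace ℝ E₂] (A : E₁ →L[ℝ] E₂) (x : E₁) :
    fderiv ℝ (fderiv ℝ A) x = 0 := by
  have : fderiv ℝ A = fun _ => A := funext fun x => A.fderiv
  rw [this]
  simp

/-- The product rule of second order at the identity of a Lie group. -/
theorem fderiv_fderiv_oneChart_mul (hX : ContMDiffAt 𝓘(ℝ, P) 𝓘(ℝ, E) ∞ X p) (hX1 : X p = 1)
    (hY : ContMDiffAt 𝓘(ℝ, P) 𝓘(ℝ, E) ∞ Y p) (hY1 : Y p = 1) (v w : P) :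
    fderiv ℝ (fderiv ℝ fun q => oneChart E L (X q * Y q)) p v w =
      fderiv ℝ (fderiv ℝ fun q => oneChart E L (X q)) p v w +
        fderiv ℝ (fderiv ℝ fun q => oneChart E L (Y q)) p v w +
      sndMul E L (fderiv ℝ (fun q => oneChart E L (X q)) p v)
        (fderiv ℝ (fun q => oneChart E L (Y q)) p w) +
      sndMul E L (fderiv ℝ (fun q => oneChart E L (X q)) p w)
        (fderiv ℝ (fun q => oneChart E L (Y q)) p v) := by
  have hX2 : ContDiffAt ℝ 2 (fun q => oneChart E L (X q)) p :=
    (contDiffAt_oneChart_comp hX hX1).of_le ENat.LEInfty.out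
  have hY2 : ContDiffAt ℝ 2 (fun q => oneChart E L (Y q)) p :=
    (contDiffAt_oneChart_comp hY hY1).of_le ENat.LEInfty.out
  have hg := hX2.prodMk hY2
  have hm2 : ContDiffAt ℝ 2 (chartMul E L) (oneCoord E L, oneCoord E L) :=
    contDiffAt_chartMul.of_le ENat.LEInfty.out
  have hl := Filter.eventually_of_mem (extChartAt_target_mem_nhds (I := 𝓘(ℝ, E)) (1 : L))
    fun y hy => chartMul_oneCoord (E := E) (L := L) hy
  have hr := Filter.eventually_of_mem (extChartAt_target_mem_nhds (I := 𝓘(ℝ, E)) (1 : L))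
    fun y hy => oneCoord_chartMul (E := E) (L := L) hy
  have hm2' : ContDiffAt ℝ 2 (chartMul E L) (oneChart E L (X p), oneChart E L (Y p)) := by
    rwa [hX1, hY1]
  have h1 := fderiv_fderiv_comp (ContinuousLinearMap.fst ℝ E E).contDiff.contDiffAt hg v w
  have h2 := fderiv_fderiv_comp (ContinuousLinearMap.snd ℝ E E).contDiff.contDiffAt hg v w
  rw [fderiv_fderiv_clm, ContinuousLinearMap.fderiv] at h1 h2
  simp only [zero_apply, zero_add, ContinuousLinearMap.coe_fst', ContinuousLinearMap.coe_snd']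
    at h1 h2
  have hgd := ((hX2.differentiableAt (by simp)).hasFDerivAt.prodMk
    (hY2.differentiableAt (by simp)).hasFDerivAt).fderiv
  rw [(eventually_oneChart_mul hX hX1 hY hY1).fderiv.fderiv_eq,
    fderiv_fderiv_comp (f := chartMul E L)
      (g := fun q => (oneChart E L (X q), oneChart E L (Y q))) hm2' hg, hX1, hY1,
    fderiv_localMul hm2 hl hr, fderiv_fderiv_localMul hm2 hl hr, hgd, ← h1, ← h2]
  simp only [ContinuousLinearMap.prod_apply, sndMul]
  abel

end ProductRule

/-! ### The descendent Lie group in a chart -/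

section RotaBaxterChart

theorem fderiv_clm_apply_const {E V W : Type*} [NormedAddCommGroup E] [NormedSpace ℝ E]
    [NormedAddCommGroup V] [NormedSpace ℝ V] [NormedAddCommGroup W] [NormedSpace ℝ W]
    {R : E → V →L[ℝ] W} {x : E} (hR : DifferentiableAt ℝ R x) (u : E) (w : V) :
    fderiv ℝ (fun x => R x w) x u = fderiv ℝ R x u w := by
  rw [(hR.hasFDerivAt.clm_apply (hasFDerivAt_const w x)).fderiv]
  simp

theorem oneChart_oneChart_symm_fst {E₁ E₂ L : Type*} [NormedAddCommGroup E₁] [NormedSpace ℝ E₁]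
    [NormedAddCommGroup E₂] [NormedSpace ℝ E₂] [TopologicalSpace L] [ChartedSpace E₁ L] [Group L]
    (y : E₂) :
    (fun q : E₁ × E₂ => oneChart E₁ L ((oneChart E₁ L).symm q.1)) =ᶠ[nhds (oneCoord E₁ L, y)]
      ContinuousLinearMap.fst ℝ E₁ E₂ :=
  (continuousAt_fst : Filter.Tendsto Prod.fst (nhds (oneCoord E₁ L, y))
    (nhds (oneCoord E₁ L))).eventually (eventually_chart_chart_symm (E := E₁) (1 : L))

theorem fderiv_apply_left {E₁ E₂ F : Type*} [NormedAddCommGroup E₁] [NormedSpace ℝ E₁]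
    [NormedAddCommGroup E₂] [NormedSpace ℝ E₂] [NormedAddCommGroup F] [NormedSpace ℝ F]
    {f : E₁ × E₂ → F} {p : E₁} {q : E₂} (hf : DifferentiableAt ℝ f (p, q)) (a : E₁) :
    fderiv ℝ f (p, q) (a, 0) = fderiv ℝ (fun x => f (x, q)) p a :=
  (congrArg (fun A : E₁ →L[ℝ] F => A a) (HasFDerivAt.comp (f := fun x => (x, q)) p hf.hasFDerivAt
    (hasFDerivAt_prodMk_left p q)).fderiv).symm

theorem fderiv_apply_right {E₁ E₂ F : Type*} [NormedAddCommGroup E₁] [NormedSpace ℝ E₁]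
    [NormedAddCommGroup E₂] [NormedSpace ℝ E₂] [NormedAddCommGroup F] [NormedSpace ℝ F]
    {f : E₁ × E₂ → F} {p : E₁} {q : E₂} (hf : DifferentiableAt ℝ f (p, q)) (b : E₂) :
    fderiv ℝ f (p, q) (0, b) = fderiv ℝ (fun y => f (p, y)) q b :=
  (congrArg (fun A : E₂ →L[ℝ] F => A b) (HasFDerivAt.comp (f := fun y => (p, y)) q hf.hasFDerivAt
    (hasFDerivAt_prodMk_right p q)).fderiv).symm

theorem fderiv_oneChart_oneChart_symm {E L : Type*} [NormedAddCommGroup E] [NormedSpace ℝ E]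
    [TopologicalSpace L] [ChartedSpace E L] [Group L] (v : E) :
    fderiv ℝ (fun x => oneChart E L ((oneChart E L).symm x)) (oneCoord E L) v = v := by
  have : (fun x => oneChart E L ((oneChart E L).symm x)) =ᶠ[nhds (oneCoord E L)] fun x => x :=
    eventually_chart_chart_symm (E := E) (1 : L)
  rw [this.fderiv_eq]
  simp

variable {EG EH : Type*} [NormedAddCommGroup EG] [NormedSpace ℝ EG]
  [NormedAddCommGroup EH] [NormedSpace ℝ EH]
  {G H : Type*} [TopologicalSpace G] [ChartedSpace EG G] [Group G]
  [TopologicalSpace H] [ChartedSpace EH H] [Group H]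
  (Φ : LieGroupAction EG EH G H)

theorem LieGroupAction.tangent_eq_fderiv (g : G) :
    Φ.tangent g = fderiv ℝ (fun y => oneChart EH H (Φ.toHom g ((oneChart EH H).symm y)))
      (oneCoord EH H) :=
  mfderiv_eq_fderiv_chart ((Φ.smooth_apply g).mdifferentiableAt (by simp)) (map_one _)

theorem LieGroupAction.tangent_one : Φ.tangent 1 = ContinuousLinearMap.id ℝ EH := by
  have : (fun h : H => Φ.toHom 1 h) = id := by ext; simp
  rw [LieGroupAction.tangent, this, mfderiv_id]
  rfl

variable {Φ} in
theorem RelRotaBaxter.diff_apply (𝓑 : RelRotaBaxter Φ) (u : GroupLieAlgebra 𝓘(ℝ, EH) H) :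
    𝓑.diff u = fderiv ℝ (fun y => oneChart EG G (𝓑.toFun ((oneChart EH H).symm y)))
      (oneCoord EH H) u :=
  congrArg (fun A : EH →L[ℝ] EG => A u) (mfderiv_eq_fderiv_chart
    (𝓑.smooth.mdifferentiableAt (by simp)) 𝓑.map_one)

variable {Φ} in
theorem RelRotaBaxter.dag_one (𝓑 : RelRotaBaxter Φ) : 𝓑.dag 1 = 1 := by
  simp [RelRotaBaxter.dag]

variable [LieGroup 𝓘(ℝ, EH) ∞ H]

variable {Φ} in
/-- The multiplication of the descendent Lie group to second order: to the contribution of the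
multiplication of `H` the derivative of `h ↦ Φ(𝓑 h)` is added. -/
theorem RelRotaBaxter.sndMul_descendent (𝓑 : RelRotaBaxter Φ) (a b : EH) :
    sndMul EH 𝓑.Descendent a b = sndMul EH H a b +
      fderiv ℝ (fun x => Φ.tangent (𝓑.toFun ((oneChart EH H).symm x)) b) (oneCoord EH H) a := by
  set x₀ := oneCoord EH H with hx₀
  have hX : ContMDiffAt 𝓘(ℝ, EH × EH) 𝓘(ℝ, EH) ∞
      (fun q : EH × EH => (oneChart EH H).symm q.1) (x₀, x₀) :=
    ContMDiffAt.comp (x₀, x₀) (contMDiffAt_oneChart_symm oneCoord_mem) contDiffAt_fst.contMDiffAt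
  have hX2 : ContMDiffAt 𝓘(ℝ, EH × EH) 𝓘(ℝ, EH) ∞
      (fun q : EH × EH => (oneChart EH H).symm q.2) (x₀, x₀) :=
    ContMDiffAt.comp (x₀, x₀) (contMDiffAt_oneChart_symm oneCoord_mem) contDiffAt_snd.contMDiffAt
  have hY : ContMDiffAt 𝓘(ℝ, EH × EH) 𝓘(ℝ, EH) ∞ (fun q : EH × EH =>
      Φ.toHom (𝓑.toFun ((oneChart EH H).symm q.1)) ((oneChart EH H).symm q.2)) (x₀, x₀) :=
    Φ.smooth.contMDiffAt.comp (x₀, x₀) ((𝓑.smooth.contMDiffAt.comp (x₀, x₀) hX).prodMk hX2)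
  have hY1 : Φ.toHom (𝓑.toFun ((oneChart EH H).symm x₀)) ((oneChart EH H).symm x₀) = 1 := by
    rw [oneChart_symm_oneCoord]
    exact _root_.map_one (Φ.toHom _)
  have h := fderiv_fderiv_oneChart_mul hX oneChart_symm_oneCoord hY hY1 (a, 0) (0, b)
  refine h.trans ?_
  have e1 := (oneChart_oneChart_symm_fst (E₁ := EH) (L := H) x₀)
  have hYc := (contDiffAt_oneChart_comp hY hY1).of_le (m := 2) ENat.LEInfty.out
  have h2 : fderiv ℝ (fun q : EH × EH => oneChart EH H (Φ.toHom (𝓑.toFun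
      ((oneChart EH H).symm q.1)) ((oneChart EH H).symm q.2))) (x₀, x₀) (0, b) = b := by
    rw [fderiv_apply_right (hYc.differentiableAt (by simp))]
    have h4 := congrArg (fun A : EH →L[ℝ] EH => A b) (Φ.tangent_eq_fderiv (𝓑.toFun 1))
    rw [𝓑.map_one, Φ.tangent_one] at h4
    refine Eq.trans ?_ h4.symm
    simp only [hx₀, oneChart_symm_oneCoord, 𝓑.map_one]
  rw [e1.fderiv.fderiv_eq, fderiv_fderiv_clm, e1.fderiv_eq, ContinuousLinearMap.fderiv, h2,
    ← fderiv_fderiv_partial_apply hYc]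
  simp only [ContinuousLinearMap.coe_fst', sndMul_zero_left, zero_apply, zero_add, add_zero,
    Φ.tangent_eq_fderiv]
  exact add_comm _ _

variable [LieGroup 𝓘(ℝ, EG) ∞ G]

/-- The action of `G` on `H` as a map from the two charts. -/
theorem LieGroupAction.contMDiffAt_chart {z : EG} {y : EH} (hz : z ∈ (oneChart EG G).target)
    (hy : y ∈ (oneChart EH H).target) :
    ContMDiffAt 𝓘(ℝ, EG × EH) 𝓘(ℝ, EH) ∞ (fun q : EG × EH =>
      Φ.toHom ((oneChart EG G).symm q.1) ((oneChart EH H).symm q.2)) (z, y) :=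
  Φ.smooth.contMDiffAt.comp (z, y)
    ((ContMDiffAt.comp (z, y) (contMDiffAt_oneChart_symm hz) contDiffAt_fst.contMDiffAt).prodMk
      (ContMDiffAt.comp (z, y) (contMDiffAt_oneChart_symm hy) contDiffAt_snd.contMDiffAt))

theorem LieGroupAction.differentiableAt_tangent :
    DifferentiableAt ℝ (fun z => Φ.tangent ((oneChart EG G).symm z)) (oneCoord EG G) := by
  simp only [LieGroupAction.tangent_eq_fderiv]
  refine ContDiffAt.differentiableAt (n := 1) ?_ (by simp)
  refine ContDiffAt.fderiv (n := ∞) (g := fun _ => oneCoord EH H)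
    (f := fun z y => oneChart EH H (Φ.toHom ((oneChart EG G).symm z) ((oneChart EH H).symm y)))
    ?_ contDiffAt_const (by rw [one_add_one_eq_two]; exact ENat.LEInfty.out)
  exact contDiffAt_oneChart_comp (Φ.contMDiffAt_chart oneCoord_mem oneCoord_mem)
    (by simp only [oneChart_symm_oneCoord, map_one])

theorem LieGroupAction.mdifferentiableAt_tangent :
    MDifferentiableAt 𝓘(ℝ, EG) 𝓘(ℝ, EH →L[ℝ] EH) Φ.tangent 1 := by
  have h1 : MDifferentiableAt 𝓘(ℝ, EG) 𝓘(ℝ, EH →L[ℝ] EH)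
      ((fun z => Φ.tangent ((oneChart EG G).symm z)) ∘ oneChart EG G) 1 :=
    MDifferentiableAt.comp (1 : G) Φ.differentiableAt_tangent.mdifferentiableAt
      (mdifferentiableAt_extChartAt (mem_chart_source EG 1))
  refine h1.congr_of_eventuallyEq ?_
  filter_upwards [eventually_chart_symm_chart (E := EG) (X := fun g : G => g) (p := 1)
    continuousAt_id rfl] with g hg
  rw [Function.comp_apply, hg]

theorem LieGroupAction.lieAction_apply (x : GroupLieAlgebra 𝓘(ℝ, EG) G)
    (u : GroupLieAlgebra 𝓘(ℝ, EH) H) :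
    Φ.lieAction x u =
      fderiv ℝ (fun z => Φ.tangent ((oneChart EG G).symm z)) (oneCoord EG G) x u :=
  congrArg (fun A : EG →L[ℝ] EH →L[ℝ] EH => A x u)
    (mfderiv_eq_fderiv_chart Φ.mdifferentiableAt_tangent rfl)

variable {Φ} (𝓑 : RelRotaBaxter Φ)

theorem RelRotaBaxter.mdifferentiableAt_tangent_comp :
    MDifferentiableAt 𝓘(ℝ, EH) 𝓘(ℝ, EH →L[ℝ] EH) (Φ.tangent ∘ 𝓑.toFun) 1 := by
  have hT : MDifferentiableAt 𝓘(ℝ, EG) 𝓘(ℝ, EH →L[ℝ] EH) Φ.tangent (𝓑.toFun 1) := by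
    rw [𝓑.map_one]
    exact Φ.mdifferentiableAt_tangent
  exact hT.comp (1 : H) (𝓑.smooth.mdifferentiableAt (by simp))

/-- The derivative at the identity of `h ↦ Φ(𝓑 h)` is `φ ∘ B`. -/
theorem RelRotaBaxter.fderiv_tangent_comp (a b : EH) :
    fderiv ℝ (fun x => Φ.tangent (𝓑.toFun ((oneChart EH H).symm x)) b) (oneCoord EH H) a =
      Φ.lieAction (𝓑.diff a) b := by
  have hB : MDifferentiableAt 𝓘(ℝ, EH) 𝓘(ℝ, EG) 𝓑.toFun 1 :=
    𝓑.smooth.mdifferentiableAt (by simp)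
  have h1 := mfderiv_eq_fderiv_chart 𝓑.mdifferentiableAt_tangent_comp rfl
  have h2 := mfderiv_comp_of_eq (x := (1 : H)) Φ.mdifferentiableAt_tangent hB 𝓑.map_one
  -- the type of the derivative depends on the base point `𝓑 1`, which is generalized to be rewritten
  have key : ∀ g : G, g = 1 → (show EG →L[ℝ] EH →L[ℝ] EH from
      mfderiv 𝓘(ℝ, EG) 𝓘(ℝ, EH →L[ℝ] EH) Φ.tangent g) (𝓑.diff a) b =
        Φ.lieAction (𝓑.diff a) b := by
    rintro _ rfl
    rfl
  have hσ : MDifferentiableAt 𝓘(ℝ, EH) 𝓘(ℝ, EH) (oneChart EH H).symm (oneCoord EH H) :=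
    (contMDiffAt_oneChart_symm oneCoord_mem).mdifferentiableAt (by simp)
  have hT : MDifferentiableAt 𝓘(ℝ, EH) 𝓘(ℝ, EH →L[ℝ] EH) (Φ.tangent ∘ 𝓑.toFun)
      ((oneChart EH H).symm (oneCoord EH H)) := by
    rw [oneChart_symm_oneCoord]
    exact 𝓑.mdifferentiableAt_tangent_comp
  have hd : DifferentiableAt ℝ (fun x => Φ.tangent (𝓑.toFun ((oneChart EH H).symm x)))
      (oneCoord EH H) := (hT.comp _ hσ).differentiableAt
  rw [fderiv_clm_apply_const hd]
  refine Eq.trans ?_ (key _ 𝓑.map_one)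
  refine Eq.trans ?_ (congrArg (fun A : EH →L[ℝ] EH →L[ℝ] EH => A a b) (h1.symm.trans h2))
  simp
  rfl

/-- The inversion `h ↦ h†` has derivative `-1` at the identity. -/
theorem RelRotaBaxter.fderiv_dag (u : EH) :
    fderiv ℝ (fun x => oneChart EH H (𝓑.dag ((oneChart EH H).symm x))) (oneCoord EH H) u = -u := by
  have hY : ContMDiffAt 𝓘(ℝ, EH) 𝓘(ℝ, EH) ∞ (oneChart EH 𝓑.Descendent).symm (oneCoord EH H) :=
    contMDiffAt_oneChart_symm oneCoord_mem
  have h := fderiv_oneChart_mul (L := 𝓑.Descendent) hY.inv (by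
    rw [show (oneChart EH 𝓑.Descendent).symm (oneCoord EH H) = 1 from oneChart_symm_oneCoord]
    exact inv_one) hY oneChart_symm_oneCoord u
  simp only [inv_mul_cancel] at h
  have h2 := fderiv_oneChart_oneChart_symm (L := 𝓑.Descendent) u
  have h3 : fderiv ℝ (fun _ : EH => oneChart EH 𝓑.Descendent 1) (oneCoord EH H) u = 0 := by simp
  rw [h3] at h
  have h4 := h.trans (congrArg _ h2)
  exact eq_neg_of_add_eq_zero_left h4.symm

end RotaBaxterChart

/-! ### The differentials of the descendent structures -/

section DescendentDifferentials

/-- The chain rule at the identities of two Lie groups. -/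
theorem fderiv_oneChart_comp {E E' P L L' : Type*} [NormedAddCommGroup E] [NormedSpace ℝ E]
    [NormedAddCommGroup E'] [NormedSpace ℝ E'] [NormedAddCommGroup P] [NormedSpace ℝ P]
    [TopologicalSpace L] [ChartedSpace E L] [Group L] [LieGroup 𝓘(ℝ, E) ∞ L]
    [TopologicalSpace L'] [ChartedSpace E' L'] [Group L'] [LieGroup 𝓘(ℝ, E') ∞ L']
    {f : L → L'} {X : P → L} {p : P} (hf : ContMDiffAt 𝓘(ℝ, E) 𝓘(ℝ, E') ∞ f 1) (hf1 : f 1 = 1)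
    (hX : ContMDiffAt 𝓘(ℝ, P) 𝓘(ℝ, E) ∞ X p) (hX1 : X p = 1) (v : P) :
    fderiv ℝ (fun q => oneChart E' L' (f (X q))) p v =
      fderiv ℝ (fun x => oneChart E' L' (f ((oneChart E L).symm x))) (oneCoord E L)
        (fderiv ℝ (fun q => oneChart E L (X q)) p v) := by
  have he : (fun q => oneChart E' L' (f (X q))) =ᶠ[nhds p]
      fun q => oneChart E' L' (f ((oneChart E L).symm (oneChart E L (X q)))) := by
    filter_upwards [eventually_chart_symm_chart (E := E) hX.continuousAt hX1] with q hq
    rw [hq]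
  have hfσ : ContMDiffAt 𝓘(ℝ, E) 𝓘(ℝ, E') ∞ (fun x => f ((oneChart E L).symm x))
      (oneCoord E L) := by
    refine ContMDiffAt.comp (oneCoord E L) (g := f) ?_ (contMDiffAt_oneChart_symm oneCoord_mem)
    rwa [oneChart_symm_oneCoord]
  have hd := ((contDiffAt_oneChart_comp hfσ
    (by rw [oneChart_symm_oneCoord, hf1])).differentiableAt (by simp)).hasFDerivAt
  have hd' : HasFDerivAt (fun x => oneChart E' L' (f ((oneChart E L).symm x)))
      (fderiv ℝ (fun x => oneChart E' L' (f ((oneChart E L).symm x))) (oneCoord E L))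
      (oneChart E L (X p)) := by
    rw [hX1]
    exact hd
  have h := HasFDerivAt.comp (f := fun q => oneChart E L (X q)) p hd'
    ((contDiffAt_oneChart_comp hX hX1).differentiableAt (by simp)).hasFDerivAt
  rw [he.fderiv_eq]
  exact congrArg (fun A : P →L[ℝ] E' => A v) h.fderiv

variable {EG EH : Type*} [NormedAddCommGroup EG] [NormedSpace ℝ EG]
  [NormedAddCommGroup EH] [NormedSpace ℝ EH]
  {G H : Type*} [TopologicalSpace G] [ChartedSpace EG G] [Group G]
  [TopologicalSpace H] [ChartedSpace EH H] [Group H]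
  [LieGroup 𝓘(ℝ, EG) ∞ G] [LieGroup 𝓘(ℝ, EH) ∞ H]
  {Φ : LieGroupAction EG EH G H} (𝓑 : RelRotaBaxter Φ)

theorem RelRotaBaxter.tangentAct_eq_fderiv (h : H) :
    𝓑.tangentAct h = fderiv ℝ (fun y => oneChart EG G (𝓑.act h ((oneChart EG G).symm y)))
      (oneCoord EG G) :=
  mfderiv_eq_fderiv_chart ((𝓑.contMDiff_act.comp
    (contMDiff_const.prodMk contMDiff_id)).mdifferentiableAt (by simp)) (𝓑.act_apply_one h)

/-- The derivative at the identity of the representation `Θ`. Both sides of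
`𝓑(Φ(g) h†) Θ(h)(g) = g 𝓑(h†)` are expanded to second order at the identity, and the terms that
are linear in `g` and in `h` are compared. -/
theorem RelRotaBaxter.fderiv_tangentAct (u : EH) (w : EG) :
    fderiv ℝ (fun x => 𝓑.tangentAct ((oneChart EH H).symm x) w) (oneCoord EH H) u =
      fderiv ℝ (fun x => oneChart EG G (𝓑.toFun ((oneChart EH H).symm x))) (oneCoord EH H)
        (fderiv ℝ (fun z => Φ.tangent ((oneChart EG G).symm z)) (oneCoord EG G) w u) +
      skewSnd (chartMul EG G) (oneCoord EG G)
        (fderiv ℝ (fun x => oneChart EG G (𝓑.toFun ((oneChart EH H).symm x))) (oneCoord EH H) u)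
        w := by
  have s1 : (oneChart EH H).symm (oneCoord EH H) = 1 := oneChart_symm_oneCoord
  have s2 : (oneChart EG G).symm (oneCoord EG G) = 1 := oneChart_symm_oneCoord
  set x₀ := oneCoord EH H
  set y₀ := oneCoord EG G
  set DB := fderiv ℝ (fun x => oneChart EG G (𝓑.toFun ((oneChart EH H).symm x))) x₀
  have hσ : ContMDiffAt 𝓘(ℝ, EH) 𝓘(ℝ, EH) ∞ (oneChart EH H).symm x₀ :=
    contMDiffAt_oneChart_symm oneCoord_mem
  have hdag : ContMDiffAt 𝓘(ℝ, EH) 𝓘(ℝ, EH) ∞ (fun x => 𝓑.dag ((oneChart EH H).symm x)) x₀ :=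
    𝓑.contMDiff_dag.contMDiffAt.comp x₀ hσ
  have hh : ContMDiffAt 𝓘(ℝ, EH × EG) 𝓘(ℝ, EH) ∞
      (fun q : EH × EG => (oneChart EH H).symm q.1) (x₀, y₀) :=
    ContMDiffAt.comp (x₀, y₀) (contMDiffAt_oneChart_symm oneCoord_mem) contDiffAt_fst.contMDiffAt
  have hg : ContMDiffAt 𝓘(ℝ, EH × EG) 𝓘(ℝ, EG) ∞
      (fun q : EH × EG => (oneChart EG G).symm q.2) (x₀, y₀) :=
    ContMDiffAt.comp (x₀, y₀) (contMDiffAt_oneChart_symm oneCoord_mem) contDiffAt_snd.contMDiffAt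
  have hd : ContMDiffAt 𝓘(ℝ, EH × EG) 𝓘(ℝ, EH) ∞
      (fun q : EH × EG => 𝓑.dag ((oneChart EH H).symm q.1)) (x₀, y₀) :=
    𝓑.contMDiff_dag.contMDiffAt.comp (x₀, y₀) hh
  have hA : ContMDiffAt 𝓘(ℝ, EH × EG) 𝓘(ℝ, EG) ∞ (fun q : EH × EG => 𝓑.toFun
      (Φ.toHom ((oneChart EG G).symm q.2) (𝓑.dag ((oneChart EH H).symm q.1)))) (x₀, y₀) :=
    𝓑.smooth.contMDiffAt.comp (x₀, y₀) (Φ.smooth.contMDiffAt.comp (x₀, y₀) (hg.prodMk hd))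
  have hT : ContMDiffAt 𝓘(ℝ, EH × EG) 𝓘(ℝ, EG) ∞ (fun q : EH × EG => 𝓑.act
      ((oneChart EH H).symm q.1) ((oneChart EG G).symm q.2)) (x₀, y₀) :=
    𝓑.contMDiff_act.contMDiffAt.comp (x₀, y₀) (hh.prodMk hg)
  have hQ : ContMDiffAt 𝓘(ℝ, EH × EG) 𝓘(ℝ, EG) ∞
      (fun q : EH × EG => 𝓑.toFun (𝓑.dag ((oneChart EH H).symm q.1))) (x₀, y₀) :=
    𝓑.smooth.contMDiffAt.comp (x₀, y₀) hd
  have hA1 : 𝓑.toFun (Φ.toHom ((oneChart EG G).symm y₀) (𝓑.dag ((oneChart EH H).symm x₀))) = 1 := by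
    rw [s1, s2, 𝓑.dag_one, _root_.map_one (Φ.toHom _), 𝓑.map_one]
  have hT1 : 𝓑.act ((oneChart EH H).symm x₀) ((oneChart EG G).symm y₀) = 1 := by
    rw [s2, 𝓑.act_apply_one]
  have hQ1 : 𝓑.toFun (𝓑.dag ((oneChart EH H).symm x₀)) = 1 := by
    rw [s1, 𝓑.dag_one, 𝓑.map_one]
  have cA := (contDiffAt_oneChart_comp hA hA1).of_le (m := 2) ENat.LEInfty.out
  have cT := (contDiffAt_oneChart_comp hT hT1).of_le (m := 2) ENat.LEInfty.out
  have cQ := (contDiffAt_oneChart_comp hQ hQ1).of_le (m := 2) ENat.LEInfty.out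
  have cY := (contDiffAt_oneChart_comp hg s2).of_le (m := 2) ENat.LEInfty.out
  have dA := cA.differentiableAt (by simp)
  have dT := cT.differentiableAt (by simp)
  have dQ := cQ.differentiableAt (by simp)
  have dY := cY.differentiableAt (by simp)
  -- the derivative of `h ↦ 𝓑(h†)`
  have hDBdag : fderiv ℝ (fun x => oneChart EG G (𝓑.toFun (𝓑.dag ((oneChart EH H).symm x)))) x₀ u =
      -DB u := by
    rw [fderiv_oneChart_comp 𝓑.smooth.contMDiffAt 𝓑.map_one hdag (by rw [s1, 𝓑.dag_one]),
      𝓑.fderiv_dag, map_neg]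
  -- the first derivatives
  have a1 := fderiv_apply_left dA u
  have a2 := fderiv_apply_right dA w
  have t1 := fderiv_apply_left dT u
  have t2 := fderiv_apply_right dT w
  have q1 := fderiv_apply_left dQ u
  have q2 := fderiv_apply_right dQ w
  have y1 := fderiv_apply_left dY u
  have y2 := fderiv_apply_right dY w
  simp only [s1, s2, _root_.map_one, MulAut.one_apply, 𝓑.dag_one, 𝓑.map_one, 𝓑.act_apply_one,
    𝓑.one_act, hDBdag, fderiv_fun_const, Pi.zero_apply, zero_apply] at a1 a2 t1 t2 q1 q2 y1 y2
  rw [fderiv_oneChart_oneChart_symm] at t2 y2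
  -- the mixed second derivatives
  have A2 := fderiv_fderiv_partial_apply' cA u w
  have T2 := fderiv_fderiv_partial_apply cT u w
  have Q2 := fderiv_fderiv_partial_apply' cQ u w
  have Y2 := fderiv_fderiv_partial_apply cY u w
  simp only [fderiv_fun_const, Pi.zero_apply, zero_apply] at T2 Q2 Y2
  have hin : ∀ y : EG, fderiv ℝ (fun x => oneChart EG G (𝓑.toFun (Φ.toHom ((oneChart EG G).symm y)
      (𝓑.dag ((oneChart EH H).symm x))))) x₀ u =
        -DB (Φ.tangent ((oneChart EG G).symm y) u) := by
    intro y
    have hX : ContMDiffAt 𝓘(ℝ, EH) 𝓘(ℝ, EH) ∞ (fun x => Φ.toHom ((oneChart EG G).symm y)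
        (𝓑.dag ((oneChart EH H).symm x))) x₀ := (Φ.smooth_apply _).contMDiffAt.comp x₀ hdag
    have hX1 : Φ.toHom ((oneChart EG G).symm y) (𝓑.dag ((oneChart EH H).symm x₀)) = 1 := by
      rw [s1, 𝓑.dag_one, _root_.map_one (Φ.toHom _)]
    rw [fderiv_oneChart_comp 𝓑.smooth.contMDiffAt 𝓑.map_one hX hX1,
      fderiv_oneChart_comp (f := fun h => Φ.toHom ((oneChart EG G).symm y) h)
        (Φ.smooth_apply _).contMDiffAt (_root_.map_one (Φ.toHom _)) hdag
        (by rw [s1, 𝓑.dag_one]), 𝓑.fderiv_dag, ← Φ.tangent_eq_fderiv, map_neg, map_neg]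
  simp only [hin] at A2
  have hφ := (DB.hasFDerivAt.comp y₀ (Φ.differentiableAt_tangent.clm_apply
    (differentiableAt_const u)).hasFDerivAt).neg.fderiv
  have hφ' := (congrArg (fun A : EG →L[ℝ] EG => A w) hφ)
  have A3 := (A2.symm.trans hφ').trans (c := -DB (fderiv ℝ (fun z => Φ.tangent
    ((oneChart EG G).symm z)) y₀ w u)) (by
      rw [neg_apply, ContinuousLinearMap.comp_apply]
      exact congrArg (fun a => -DB a) (fderiv_clm_apply_const Φ.differentiableAt_tangent w u))
  have key := fderiv_fderiv_oneChart_mul hA hA1 hT hT1 (u, 0) (0, w)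
  have key' := fderiv_fderiv_oneChart_mul hg s2 hQ hQ1 (u, 0) (0, w)
  -- the two sides of `𝓑(Φ(g) h†) Θ(h)(g) = g 𝓑(h†)`
  have hmul : ∀ (h : H) (g : G), 𝓑.toFun (Φ.toHom g (𝓑.dag h)) * 𝓑.act h g =
      g * 𝓑.toFun (𝓑.dag h) := fun h g => by rw [RelRotaBaxter.act]; group
  simp only [hmul] at key
  rw [key', ← T2, ← Q2, ← Y2, A3, a1, a2, t1, t2, q1, q2, y1, y2] at key
  simp only [sndMul_zero_left, sndMul_neg_left, sndMul_neg_right] at key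
  simp only [𝓑.tangentAct_eq_fderiv]
  change _ = _ + (sndMul EG G (DB u) w - sndMul EG G w (DB u))
  refine eq_of_sub_eq_zero ?_
  rw [← sub_eq_zero] at key
  rw [← neg_eq_zero, ← key]
  abel

/-- The descendent bracket is the Lie bracket of the descendent Lie group, in its chart. -/
theorem RelRotaBaxter.descendentBracket_eq_skewSnd [CompleteSpace EG] [CompleteSpace EH] (a b : EH) :
    descendentBracket (𝔤 := GroupLieAlgebra 𝓘(ℝ, EG) G) (𝔥 := GroupLieAlgebra 𝓘(ℝ, EH) H)
      Φ.lieAction 𝓑.diff a b =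
      skewSnd (chartMul EH 𝓑.Descendent) (oneCoord EH 𝓑.Descendent) a b := by
  have h := 𝓑.sndMul_descendent a b
  have h' := 𝓑.sndMul_descendent b a
  have e := 𝓑.fderiv_tangent_comp a b
  have e' := 𝓑.fderiv_tangent_comp b a
  have hl := lie_eq_skewSnd_chartMul (E := EH) (L := H) a b
  have h1 : skewSnd (chartMul EH 𝓑.Descendent) (oneCoord EH 𝓑.Descendent) a b =
    fderiv ℝ (fun x => Φ.tangent (𝓑.toFun ((oneChart EH H).symm x)) b) (oneCoord EH H) a -
    fderiv ℝ (fun x => Φ.tangent (𝓑.toFun ((oneChart EH H).symm x)) a) (oneCoord EH H) b +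
      skewSnd (chartMul EH H) (oneCoord EH H) a b := by
    change sndMul EH 𝓑.Descendent a b - sndMul EH 𝓑.Descendent b a =
      _ + (sndMul EH H a b - sndMul EH H b a)
    rw [h, h']
    abel
  refine Eq.trans ?_ h1.symm
  exact (congrArg₂ (fun x y : EH => x + y) (congrArg₂ (fun x y : EH => x - y) e e') hl.symm).symm

/-- The representation of the descendent Lie algebra is the derivative of `Θ` at the identity. -/
theorem RelRotaBaxter.descendentRep_eq_fderiv [CompleteSpace EG] [CompleteSpace EH] (u : EH) :
    ⇑(descendentRep (𝔤 := GroupLieAlgebra 𝓘(ℝ, EG) G) (𝔥 := GroupLieAlgebra 𝓘(ℝ, EH) H)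
      Φ.lieAction 𝓑.diff u) =
      fderiv ℝ (fun x => 𝓑.rep.toHom ((oneChart EH 𝓑.Descendent).symm x))
        (oneCoord EH 𝓑.Descendent) u := by
  funext w
  have hd : DifferentiableAt ℝ (fun x => 𝓑.rep.toHom ((oneChart EH 𝓑.Descendent).symm x))
      (oneCoord EH 𝓑.Descendent) :=
    ((contDiffOn_rep 𝓑.rep).contDiffAt
      ((isOpen_extChartAt_target 1).mem_nhds oneCoord_mem)).differentiableAt (by simp)
  have h2 := fderiv_clm_apply_const (E := EH) (V := EG) (W := EG)
    (R := fun x => 𝓑.rep.toHom ((oneChart EH 𝓑.Descendent).symm x)) hd u w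
  refine Eq.trans ?_ ((𝓑.fderiv_tangentAct u w).symm.trans h2)
  have hl := lie_eq_skewSnd_chartMul (E := EG) (L := G) (𝓑.diff u) w
  have e := Φ.lieAction_apply w u
  refine congrArg₂ (fun x y : EG => x + y) ?_ ?_
  · exact (𝓑.diff_apply _).trans (congrArg _ e)
  · exact hl.trans (congrArg (fun x : EG => skewSnd (chartMul EG G) (oneCoord EG G) x w)
      (𝓑.diff_apply u))

end DescendentDifferentials

/-! ### The Van Est cochain map -/

section VanEstLinear

variable {E : Type*} [NormedAddCommGroup E] [NormedSpace ℝ E]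
  {L : Type*} [TopologicalSpace L] [ChartedSpace E L] [Group L] [LieGroup 𝓘(ℝ, E) ∞ L]
  {V : Type*} [NormedAddCommGroup V] [NormedSpace ℝ V]

theorem alternatization_apply_eq_altSum {V W : Type*} [AddCommGroup V] [Module ℝ V]
    [AddCommGroup W] [Module ℝ W] {n : ℕ} (m : MultilinearMap ℝ (fun _ : Fin n => V) W)
    (u : Fin n → V) : MultilinearMap.alternatization m u = altSum m u := by
  rw [MultilinearMap.alternatization_apply, altSum]
  refine Finset.sum_congr rfl fun s _ => ?_
  rw [Int.cast_smul_eq_zsmul]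
  rfl

variable (E L V) in
/-- The Van Est map as a linear map into alternating maps: the alternatization of the mixed
derivative at the identity of a cochain in the chart. -/
def vanEstLinear (n : ℕ) : SmoothCochain E L V n →ₗ[ℝ] (E [⋀^Fin n]→ₗ[ℝ] V) where
  toFun F := MultilinearMap.alternatization
    (mixedFDeriv (oneCoord E L) n (chartCochain E F.1)).toMultilinearMap
  map_add' F F' := by
    have h := mixedFDeriv_add (isOpen_extChartAt_target 1) oneCoord_mem
      (contDiffOn_chartCochain F) (contDiffOn_chartCochain F')
    rw [← map_add]
    exact congrArg (fun m : E [×n]→L[ℝ] V => MultilinearMap.alternatization m.toMultilinearMap) h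
  map_smul' c F := by
    have h := mixedFDeriv_smul (isOpen_extChartAt_target 1) oneCoord_mem c
      (contDiffOn_chartCochain F)
    ext u
    rw [RingHom.id_apply, AlternatingMap.smul_apply, alternatization_apply_eq_altSum,
      alternatization_apply_eq_altSum, ← altSum_smul]
    exact congrArg (fun m : E [×n]→L[ℝ] V => altSum m u) h

theorem vanEstLinear_apply {n : ℕ} (F : SmoothCochain E L V n) (u : Fin n → E) :
    vanEstLinear E L V n F u =
      altSum (fun v : Fin n → E => mixedFDeriv (oneCoord E L) n (chartCochain E F.1) v) u :=
  alternatization_apply_eq_altSum _ u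

end VanEstLinear

section CochainMap

variable {C D : ℕ → Type*} [∀ n, AddCommGroup (C n)] [∀ n, Module ℝ (C n)]
  [∀ n, AddCommGroup (D n)] [∀ n, Module ℝ (D n)]

/-- A cochain map induces maps in cohomology. -/
theorem exists_cohomology_map (d : ∀ n, C n →ₗ[ℝ] C (n + 1)) (d' : ∀ n, D n →ₗ[ℝ] D (n + 1))
    (f : ∀ n, C n →ₗ[ℝ] D n) (hf : ∀ n c, f (n + 1) (d n c) = d' n (f n c)) :
    ∃ fs : ∀ n, Cohomology d n →ₗ[ℝ] Cohomology d' n, ∀ (n : ℕ) (c : C n) (hc : d n c = 0),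
      ∃ h : d' n (f n c) = 0, fs n (Cohomology.mk d c hc) = Cohomology.mk d' (f n c) h := by
  have h0 : ∀ n c, d n c = 0 → d' n (f n c) = 0 := fun n c hc => by rw [← hf, hc, map_zero]
  refine ⟨fun n => Submodule.mapQ _ _ ((f n).restrict (h0 n)) ?_, fun n c hc => ⟨h0 n c hc, rfl⟩⟩
  rintro ⟨c, hc⟩ hb
  change c ∈ coboundaries d n at hb
  change f n c ∈ coboundaries d' n
  cases n with
  | zero =>
    rw [coboundaries, Submodule.mem_bot] at hb ⊢
    rw [hb, map_zero]
  | succ n =>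
    obtain ⟨b, rfl⟩ := hb
    exact ⟨f n b, (hf n b).symm⟩

end CochainMap

end RotaBaxter

end

theorem mainTheorem4 {EG EH : Type*}
    [NormedAddCommGroup EG] [NormedSpace ℝ EG] [FiniteDimensional ℝ EG]
    [NormedAddCommGroup EH] [NormedSpace ℝ EH] [FiniteDimensional ℝ EH]
    {G H : Type*}
    [TopologicalSpace G] [T2Space G] [ChartedSpace EG G] [Group G] [LieGroup 𝓘(ℝ, EG) ∞ G]
    [TopologicalSpace H] [T2Space H] [ChartedSpace EH H] [Group H] [LieGroup 𝓘(ℝ, EH) ∞ H]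
    (Φ : LieGroupAction EG EH G H) (𝓑 : RelRotaBaxter Φ) :
    ∃ VE : ∀ n : ℕ, SmoothCochain EH 𝓑.Descendent EG n →ₗ[ℝ]
        (GroupLieAlgebra 𝓘(ℝ, EH) H [⋀^Fin n]→ₗ[ℝ] GroupLieAlgebra 𝓘(ℝ, EG) G),
      (∀ (n : ℕ) (F : SmoothCochain EH 𝓑.Descendent EG n)
        (u : Fin n → GroupLieAlgebra 𝓘(ℝ, EH) H), VE n F u = 𝓑.vanEst F u) ∧
      (∀ (n : ℕ) (F : SmoothCochain EH 𝓑.Descendent EG n),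
        VE (n + 1) (𝓑.rep.d n F) = lieD Φ.lieAction 𝓑.diff n (VE n F)) ∧
      ∃ VEs : ∀ n : ℕ, Cohomology 𝓑.rep.d n →ₗ[ℝ] Cohomology (lieD Φ.lieAction 𝓑.diff) n,
        ∀ (n : ℕ) (F : SmoothCochain EH 𝓑.Descendent EG n) (hF : 𝓑.rep.d n F = 0),
          ∃ hVE : lieD Φ.lieAction 𝓑.diff n (VE n F) = 0,
            VEs n (Cohomology.mk 𝓑.rep.d F hF) =
              Cohomology.mk (lieD Φ.lieAction 𝓑.diff) (VE n F) hVE := by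
  have hd : ∀ (n : ℕ) (F : SmoothCochain EH 𝓑.Descendent EG n),
      vanEstLinear EH 𝓑.Descendent EG (n + 1) (𝓑.rep.d n F) =
        lieD Φ.lieAction 𝓑.diff n (vanEstLinear EH 𝓑.Descendent EG n F) := fun n F =>
    AlternatingMap.ext fun u => (vanEstLinear_apply _ u).trans
      (altSum_mixedFDeriv_d 𝓑.rep F (descendentBracket Φ.lieAction 𝓑.diff)
        𝓑.descendentBracket_eq_skewSnd (descendentRep Φ.lieAction 𝓑.diff)
        𝓑.descendentRep_eq_fderiv _ (vanEstLinear_apply F) u)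
  have hv : ∀ {n : ℕ} (F : SmoothCochain EH 𝓑.Descendent EG n)
      (u : Fin n → GroupLieAlgebra 𝓘(ℝ, EH) 𝓑.Descendent), vanEst F.1 u = altSum (fun v : Fin n →
        EH => mixedFDeriv (oneCoord EH 𝓑.Descendent) n (chartCochain EH F.1) v) u :=
    fun F u => vanEst_eq_altSum F u
  exact ⟨vanEstLinear EH 𝓑.Descendent EG,
    fun n F u => (vanEstLinear_apply F u).trans (hv F u).symm, hd,
    exists_cohomology_map _ _ _ hd⟩
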